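/- For a group $G$ let $G^{ab}$ be its abelianization, $H_n(G)$ its $n$-th homology group with coefficients in the trivial module $\mathbb Z$, $M(G)=H_2(G)$ its Schur multiplier, and $K(G)$ its functorial Eilenberg–MacLane space $K(G,1)$, so that $H_n(G)\cong H_n(K(G))$. For a normal subgroup $N\trianglelefteq G$ let $X(G,N)$ be the homotopy pushout of $K(G/N)\leftarrow K(G)\rightarrow *$ (equivalently, the mapping cone of $K(G)\to K(G/N)$), and let $M(G,N)=H_3(X(G,N))$ be the Schur multiplier of the pair $(G,N)$. **Theorem 2.5.** Let $G_1,G_2$ be groups, $N_i\trianglelefteq G_i$ $(i=1,2)$ normal subgroups, $G=G_1\times G_2$, $N=N_1\times N_2$, $Q_i=G_i/N_i$, and $X=X(G,N)$. There are isomorphisms $$H_3(G_1\times G_2)\cong H_3(G_1)\oplus (M(G_1)\otimes G_2^{ab})\oplus (G_1^{ab}\otimes M(G_2))\oplus H_3(G_2)\oplus \mathrm{Tor}(G_1^{ab},G_2^{ab}),$$ $$H_3(Q_1\times Q_2)\cong H_3(Q_1)\oplus (M(Q_1)\otimes Q_2^{ab})\oplus (Q_1^{ab}\otimes M(Q_2))\oplus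 H_3(Q_2)\oplus \mathrm{Tor}(Q_1^{ab},Q_2^{ab})$$ (tensor products and $\mathrm{Tor}=\mathrm{Tor}_1$ over $\mathbb Z$) and a long exact sequence $$\cdots\to H_4(Q_1\times Q_2)\to H_4(X)\to H_3(G_1)\oplus (M(G_1)\otimes G_2^{ab})\oplus (G_1^{ab}\otimes M(G_2))\oplus H_3(G_2)\oplus \mathrm{Tor}(G_1^{ab},G_2^{ab})$$ $$\to H_3(Q_1)\oplus (M(Q_1)\otimes Q_2^{ab})\oplus (Q_1^{ab}\otimes M(Q_2))\oplus H_3(Q_2)\oplus \mathrm{Tor}(Q_1^{ab},Q_2^{ab})$$ $$\to M(G_1\times G_2,N_1\times N_2)\to M(G_1\times G_2)\to M(Q_1\times Q_2)\to H_2(X)\to H_1(G_1\times G_2)\to H_1(Q_1\times Q_2)\to 0,$$ whose remaining terms on the left are $\cdots\to H_{n+1}(X)\to H_n(G_1\times G_2)\to H_n(Q_1\times Q_2)\to H_n(X)\to\cdots$ for $n\ge 4$. Here the maps from the homology of $G_1\times G_2$ to that of $Q_1\times Q_2$ are induced by the projection $G_1\times G_2\to Q_1\times Q_2$ (in degree three,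 via the two isomorphisms above), and the maps from the homology of $Q_1\times Q_2$ to that of $X$ are induced by the canonical map $K(G/N)\to X$, under the identification of group homology with the homology of Eilenberg–MacLane spaces. -/

import Mathlib

universe u

open CategoryTheory Limits MonoidalCategory Simplicial
open scoped TensorProduct

noncomputable section

namespace SchurPair

/-- The ring of integers, placed in the universe `u` of the groups under consideration.
Modules over it are the same thing as abelian groups. -/
abbrev ZZ : Type u := ULift.{u} ℤ

/-! ### Homology of groups with integer coefficients -/

/-- `H_n(G)`, the `n`-th homology group of `G` with coefficients in the trivial module of
integers. -/
abbrev grpHomology (n : ℕ) (G : Type u) [Group G] : ModuleCat.{u} ZZ.{u} :=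
  groupHomology (Rep.trivial ZZ.{u} G ZZ.{u}) n

/-- The map `H_n(G) → H_n(G')` induced by a group homomorphism `f : G → G'` (and the identity on
the coefficients). -/
def grpHomologyMap (n : ℕ) {G G' : Type u} [Group G] [Group G'] (f : G →* G') :
    grpHomology n G →ₗ[ZZ.{u}] grpHomology n G' :=
  (groupHomology.map (A := Rep.trivial ZZ.{u} G ZZ.{u}) (B := Rep.trivial ZZ.{u} G' ZZ.{u}) f
    (𝟙 (Rep.trivial ZZ.{u} G ZZ.{u})) n).hom

/-- The Schur multiplier `M(G) = H_2(G)`. -/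
abbrev schurMultiplier (G : Type u) [Group G] : ModuleCat.{u} ZZ.{u} := grpHomology 2 G

/-- The map `M(G) → M(G')` induced by a group homomorphism. -/
abbrev schurMultiplierMap {G G' : Type u} [Group G] [Group G'] (f : G →* G') :
    schurMultiplier G →ₗ[ZZ.{u}] schurMultiplier G' :=
  grpHomologyMap 2 f

/-- The abelianization `G^ab`, written additively. -/
abbrev Ab (G : Type u) [Group G] : Type u := Additive (Abelianization G)

/-- `Tor_1` of two abelian groups. -/
abbrev torOne (A B : Type u) [AddCommGroup A] [AddCommGroup B] : ModuleCat.{u} ZZ.{u} :=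
  ((Tor (ModuleCat.{u} ZZ.{u}) 1).obj (ModuleCat.of ZZ.{u} A)).obj (ModuleCat.of ZZ.{u} B)

/-- The group
`H_3(A) ⊕ (M(A) ⊗ B^ab) ⊕ (A^ab ⊗ M(B)) ⊕ H_3(B) ⊕ Tor(A^ab, B^ab)`. -/
abbrev kunnethThree (A B : Type u) [Group A] [Group B] : Type u :=
  grpHomology 3 A ×
    (schurMultiplier A ⊗[ZZ.{u}] Ab B) ×
    (Ab A ⊗[ZZ.{u}] schurMultiplier B) ×
    grpHomology 3 B ×
    torOne (Ab A) (Ab B)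

/-! ### Eilenberg–MacLane spaces and homotopy pushouts, as simplicial sets -/

/-- Integral homology of the space presented by a simplicial set `S` (that is, the singular
homology of its geometric realization). -/
abbrev spaceHomology (n : ℕ) (S : SSet.{u}) : ModuleCat.{u} ZZ.{u} :=
  S.homology (ModuleCat.of ZZ.{u} ZZ.{u}) n

/-- The map in homology induced by a map of spaces. -/
abbrev spaceHomologyMap (n : ℕ) {S T : SSet.{u}} (f : S ⟶ T) :
    spaceHomology n S →ₗ[ZZ.{u}] spaceHomology n T :=
  (SSet.homologyMap f (ModuleCat.of ZZ.{u} ZZ.{u}) n).hom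

/-- The functorial Eilenberg–MacLane space `K(G) = K(G, 1)`: the nerve of `G` regarded as a
category with one object, whose geometric realization is the classifying space of `G`. -/
def eilenbergMacLane (G : Type u) [Group G] : SSet.{u} := nerve (SingleObj G)

/-- The map `K(G) → K(G')` induced by a group homomorphism. -/
def eilenbergMacLaneMap {G G' : Type u} [Group G] [Group G'] (f : G →* G') :
    eilenbergMacLane G ⟶ eilenbergMacLane G' :=
  nerveMap (SingleObj.mapHom G G' f)

/-- The homotopy pushout of `B ← A → C`, as the double mapping cylinder: the cylinder `A × [0,1]`
with its end `A × {0}` glued to `B` along `f`, and its end `A × {1}` glued to `C` along `g`. -/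
def homotopyPushout {A B C : SSet.{u}} (f : A ⟶ B) (g : A ⟶ C) : SSet.{u} :=
  pushout (coprod.map f g)
    (coprod.desc (SSet.ι₀ : A ⟶ A ⊗ Δ[1]) (SSet.ι₁ : A ⟶ A ⊗ Δ[1]))

/-- The canonical map from `B` to the homotopy pushout of `B ← A → C`. -/
def homotopyPushoutInl {A B C : SSet.{u}} (f : A ⟶ B) (g : A ⟶ C) :
    B ⟶ homotopyPushout f g :=
  coprod.inl ≫ pushout.inl (coprod.map f g)
    (coprod.desc (SSet.ι₀ : A ⟶ A ⊗ Δ[1]) (SSet.ι₁ : A ⟶ A ⊗ Δ[1]))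

/-- The map from a space to the one-point space. -/
def toPoint (A : SSet.{u}) : A ⟶ (Δ[0] : SSet.{u}) := SSet.stdSimplex.isTerminalObj₀.from A

/-- The map `K(G) → K(G/N)` induced by the projection. -/
def pairMap (G : Type u) [Group G] (N : Subgroup G) [N.Normal] :
    eilenbergMacLane G ⟶ eilenbergMacLane (G ⧸ N) :=
  eilenbergMacLaneMap (QuotientGroup.mk' N)

/-- The space `X` of a pair `(G, N)`: the homotopy pushout of `K(G/N) ← K(G) → 1`. -/
def pairSpace (G : Type u) [Group G] (N : Subgroup G) [N.Normal] : SSet.{u} :=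
  homotopyPushout (pairMap G N) (toPoint (eilenbergMacLane G))

/-- The canonical map `K(G/N) → X` of a pair `(G, N)`. -/
def pairInclusion (G : Type u) [Group G] (N : Subgroup G) [N.Normal] :
    eilenbergMacLane (G ⧸ N) ⟶ pairSpace G N :=
  homotopyPushoutInl (pairMap G N) (toPoint (eilenbergMacLane G))

/-- The Schur multiplier `M(G, N) = H_3(X)` of a pair of groups. -/
abbrev schurMultiplierPair (G : Type u) [Group G] (N : Subgroup G) [N.Normal] :
    ModuleCat.{u} ZZ.{u} :=
  spaceHomology 3 (pairSpace G N)

/-- The projection `G₁ × G₂ → G₁/N₁ × G₂/N₂`. -/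
abbrev prodProj {G₁ G₂ : Type u} [Group G₁] [Group G₂] (N₁ : Subgroup G₁) [N₁.Normal]
    (N₂ : Subgroup G₂) [N₂.Normal] : G₁ × G₂ →* (G₁ ⧸ N₁) × (G₂ ⧸ N₂) :=
  (QuotientGroup.mk' N₁).prodMap (QuotientGroup.mk' N₂)

end SchurPair

end

/-!
The long exact sequence is the homology sequence of the mapping cone `X` of `K(G) → K(G/N)`. Group
homology is identified, naturally, with the homology of `K(G)`: the simplices of `K(G)` are the
tuples of elements of `G`, and their chains are the inhomogeneous chains (`grpHomologyEquiv`). The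
cone is a pushout in which the cylinder is glued along its two ends, a monomorphism, so integral
chains give a Mayer–Vietoris sequence, which collapses to the sequence of the cone because the two
ends of the cylinder induce the same isomorphism in homology (`exists_coneSequence`). Surjectivity
on `H_1` is clear on chains, all of which are cycles in degree one.

The Künneth formula in degree three is obtained without the Eilenberg–Zilber theorem. Let `E` be the
universal cover of `K(B)` and `S` a simplicial set, and consider the double complex of inhomogeneous
chains of `B` with coefficients in the chains of `S × E` (`coverDouble`). As `B` acts freely on
`S × E`, its columns resolve the chains of the quotient `S × K(B)` (`exists_classMap_coverDouble`).
As `E` is contractible, its rows have the homology of `S`; projecting chains onto cycles, which are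
direct summands since `ℤ` is hereditary, gives an equivariant quasi-isomorphism from the chains of
`S × E` to the homology of `S` with zero differential (`exists_rowClass`). Hence
`H_3(S × K(B))` is the sum of the groups `H_q(B; H_p(S))` with constant coefficients and `p + q = 3`
(`nonempty_homology_three_addEquiv`). For `S = K(A)` these are computed in low degrees: `H_0` and
`H_1` with trivial coefficients are in Mathlib, and `H_2(B; A^ab)` is
`(A^ab ⊗ H_2(B)) ⊕ Tor(A^ab, B^ab)` by the universal coefficient theorem
(`nonempty_homology_two_addEquiv`), in which the `Tor` term comes from the presentation of `H_1(B)`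
by cycles and boundaries. Since `K(A × B)` is `K(A) × K(B)`, this gives the two isomorphisms of the
theorem (`nonempty_kunnethThree_linearEquiv`), and the maps in degree three are transported along
them.
-/

noncomputable section

namespace SchurPair

/-! ### The homology sequence of a mapping cone -/

/-- A homotopy of maps of simplicial sets, from a map out of the cylinder. -/
def homotopyOfCylinder {X Y : SSet.{u}} {f g : X ⟶ Y} (h : X ⊗ Δ[1] ⟶ Y)
    (h₀ : SSet.ι₀ ≫ h = f) (h₁ : SSet.ι₁ ≫ h = g) : SSet.Homotopy f g where
  h := h
  h₀ := h₀
  h₁ := h₁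
  rel := by
    ext n ⟨⟨x, hx⟩, t⟩
    exact hx.elim

/-- The cylinder deformed onto its end `A × {0}`. -/
def cylinderContraction (A : SSet.{u}) : (A ⊗ Δ[1]) ⊗ Δ[1] ⟶ A ⊗ Δ[1] where
  app n := TypeCat.ofHom fun x ↦ (x.1.1, SSet.stdSimplex.objMk
    ((SSet.stdSimplex.asOrderHom x.1.2) ⊓ (SSet.stdSimplex.asOrderHom x.2)))
  naturality n m f := by
    ext ⟨⟨a, s⟩, t⟩
    rfl

/-- The projection of the cylinder onto its end `A × {0}` is homotopic to the identity; the
homotopy is `(a, s, t) ↦ (a, min s t)`. -/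
def cylinderHomotopy (A : SSet.{u}) :
    SSet.Homotopy (CartesianMonoidalCategory.fst A Δ[1] ≫ SSet.ι₀) (𝟙 (A ⊗ Δ[1])) := by
  refine homotopyOfCylinder (cylinderContraction A) ?_ ?_
  · ext n ⟨a, s⟩
    · rfl
    · refine SSet.stdSimplex.ext _ _ fun i ↦ ?_
      change SSet.stdSimplex.asOrderHom s i ⊓ 0 = 0
      exact inf_of_le_right (Fin.zero_le _)
  · ext n ⟨a, s⟩
    · rfl
    · refine SSet.stdSimplex.ext _ _ fun i ↦ ?_
      change SSet.stdSimplex.asOrderHom s i ⊓ 1 = SSet.stdSimplex.asOrderHom s i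
      exact inf_of_le_left (Fin.le_last _)

/-- The integral chains of simplicial sets, as a functor. -/
abbrev chainsFunctor : SSet.{u} ⥤ ChainComplex (ModuleCat.{u} ZZ.{u}) ℕ :=
  (SSet.chainComplexFunctor (ModuleCat.{u} ZZ.{u})).obj (ModuleCat.of ZZ.{u} ZZ.{u})

instance (J : Type) [Category J] : PreservesColimitsOfShape J chainsFunctor.{u} :=
  HomologicalComplex.preservesColimitsOfShape_of_eval _ fun n ↦
    inferInstanceAs (PreservesColimitsOfShape J
      ((evaluation SimplexCategoryᵒᵖ (Type u)).obj (Opposite.op ⦋n⦌) ⋙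
        sigmaConst.obj (ModuleCat.of ZZ.{u} ZZ.{u})))

instance : chainsFunctor.{u}.PreservesMonomorphisms where
  preserves {S T} f hf := by
    have (n : ℕ) : Mono ((chainsFunctor.map f).f n) :=
      inferInstanceAs (Mono ((sigmaConst.obj _).map (f.app (Opposite.op ⦋n⦌))))
    exact HomologicalComplex.mono_of_mono_f _ this

lemma spaceHomologyMap_comp_apply (n : ℕ) {S T U : SSet.{u}} (f : S ⟶ T) (g : T ⟶ U)
    (x : spaceHomology n S) :
    spaceHomologyMap n (f ≫ g) x = spaceHomologyMap n g (spaceHomologyMap n f x) := by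
  simp [spaceHomologyMap, SSet.homologyMap_comp]

lemma spaceHomologyMap_id_apply (n : ℕ) {S : SSet.{u}} (x : spaceHomology n S) :
    spaceHomologyMap n (𝟙 S) x = x := by
  simp [spaceHomologyMap]

lemma exists_projections_of_isColimit {X Y P : ModuleCat.{u} ZZ.{u}} {i : X ⟶ P} {j : Y ⟶ P}
    (hc : IsColimit (BinaryCofan.mk i j)) :
    ∃ (p : P ⟶ X) (q : P ⟶ Y), i ≫ p = 𝟙 X ∧ j ≫ p = 0 ∧ i ≫ q = 0 ∧ j ≫ q = 𝟙 Y ∧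
      p ≫ i + q ≫ j = 𝟙 P := by
  obtain ⟨p, hp₁, hp₂⟩ : ∃ p : P ⟶ X, i ≫ p = 𝟙 X ∧ j ≫ p = 0 :=
    ⟨_, (BinaryCofan.IsColimit.desc' hc (𝟙 X) 0).2⟩
  obtain ⟨q, hq₁, hq₂⟩ : ∃ q : P ⟶ Y, i ≫ q = 0 ∧ j ≫ q = 𝟙 Y :=
    ⟨_, (BinaryCofan.IsColimit.desc' hc 0 (𝟙 Y)).2⟩
  refine ⟨p, q, hp₁, hp₂, hq₁, hq₂, BinaryCofan.IsColimit.hom_ext hc ?_ ?_⟩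
  · change i ≫ (p ≫ i + q ≫ j) = i ≫ 𝟙 P
    rw [Preadditive.comp_add, reassoc_of% hp₁, reassoc_of% hq₁, zero_comp, add_zero,
      Category.comp_id]
  · change j ≫ (p ≫ i + q ≫ j) = j ≫ 𝟙 P
    rw [Preadditive.comp_add, reassoc_of% hp₂, reassoc_of% hq₂, zero_comp, zero_add,
      Category.comp_id]

/-- The homology of a disjoint union is the direct sum of the homologies of the summands. -/
lemma spaceHomology_coprod (n : ℕ) (X Y : SSet.{u}) :
    ∃ (p : spaceHomology n (X ⨿ Y) ⟶ spaceHomology n X)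
      (q : spaceHomology n (X ⨿ Y) ⟶ spaceHomology n Y),
      (∀ x, p (spaceHomologyMap n coprod.inl x) = x) ∧
      (∀ y, p (spaceHomologyMap n coprod.inr y) = 0) ∧
      (∀ x, q (spaceHomologyMap n coprod.inl x) = 0) ∧
      (∀ y, q (spaceHomologyMap n coprod.inr y) = y) ∧
      ∀ z, spaceHomologyMap n coprod.inl (p z) + spaceHomologyMap n coprod.inr (q z) = z := by
  obtain ⟨p, q, h₁, h₂, h₃, h₄, h₅⟩ := exists_projections_of_isColimit
    (mapIsColimitOfPreservesOfIsColimit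
      (HomologicalComplex.homologyFunctor (ModuleCat.{u} ZZ.{u}) (ComplexShape.down ℕ) n) _ _
      (mapIsColimitOfPreservesOfIsColimit chainsFunctor.{u} _ _ (coprodIsCoprod X Y)))
  exact ⟨p, q, fun x ↦ congr($h₁ x), fun x ↦ congr($h₂ x), fun x ↦ congr($h₃ x),
    fun x ↦ congr($h₄ x), fun x ↦ congr($h₅ x)⟩

/-- The two ends of the cylinder are disjoint and embedded; this makes the gluing of the cylinder
in a double mapping cylinder a pushout along a monomorphism. -/
lemma mono_cylinderEnds (A : SSet.{u}) :
    Mono (coprod.desc (SSet.ι₀ : A ⟶ A ⊗ Δ[1]) (SSet.ι₁ : A ⟶ A ⊗ Δ[1])) := by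
  have (n : SimplexCategoryᵒᵖ) : Mono ((coprod.desc (SSet.ι₀ : A ⟶ A ⊗ Δ[1])
      (SSet.ι₁ : A ⟶ A ⊗ Δ[1])).app n) := by
    rw [mono_iff_injective]
    obtain ⟨hl, hr, hlr⟩ := (Types.binaryCofan_isColimit_iff _).1
      ⟨mapIsColimitOfPreservesOfIsColimit ((evaluation SimplexCategoryᵒᵖ (Type u)).obj n)
        _ _ (coprodIsCoprod A A)⟩
    have h₀ (a : A.obj n) : (coprod.desc (SSet.ι₀ : A ⟶ A ⊗ Δ[1]) SSet.ι₁).app n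
        ((coprod.inl : A ⟶ A ⨿ A).app n a) = (SSet.ι₀ : A ⟶ A ⊗ Δ[1]).app n a :=
      congr(($(coprod.inl_desc (SSet.ι₀ : A ⟶ A ⊗ Δ[1]) SSet.ι₁)).app n a)
    have h₁ (a : A.obj n) : (coprod.desc (SSet.ι₀ : A ⟶ A ⊗ Δ[1]) SSet.ι₁).app n
        ((coprod.inr : A ⟶ A ⨿ A).app n a) = (SSet.ι₁ : A ⟶ A ⊗ Δ[1]).app n a :=
      congr(($(coprod.inr_desc (SSet.ι₀ : A ⟶ A ⊗ Δ[1]) SSet.ι₁)).app n a)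
    have hz (x : (A ⨿ A : SSet.{u}).obj n) :
        (∃ a, (coprod.inl : A ⟶ A ⨿ A).app n a = x) ∨
          ∃ a, (coprod.inr : A ⟶ A ⨿ A).app n a = x := by
      have : x ∈ Set.range ((coprod.inl : A ⟶ A ⨿ A).app n) ⊔
        Set.range ((coprod.inr : A ⟶ A ⨿ A).app n) := by
        have h := hlr.sup_eq_top
        exact (Set.ext_iff.1 h x).2 trivial
      exact this
    have hne (a b : A.obj n) :
        (SSet.ι₀ : A ⟶ A ⊗ Δ[1]).app n a ≠ (SSet.ι₁ : A ⟶ A ⊗ Δ[1]).app n b := by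
      intro h
      have := congrArg (fun t : A.obj n × (Δ[1] : SSet.{u}).obj n ↦
        SSet.stdSimplex.asOrderHom t.2 0) h
      exact absurd this (show (0 : Fin 2) ≠ 1 by decide)
    rintro x y hxy
    obtain ⟨a, rfl⟩ | ⟨a, rfl⟩ := hz x <;> obtain ⟨b, rfl⟩ | ⟨b, rfl⟩ := hz y
    · rw [h₀, h₀] at hxy
      rw [show a = b from congrArg Prod.fst hxy]
    · rw [h₀, h₁] at hxy
      exact (hne _ _ hxy).elim
    · rw [h₀, h₁] at hxy
      exact (hne _ _ hxy.symm).elim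
    · rw [h₁, h₁] at hxy
      rw [show a = b from congrArg Prod.fst hxy]
  exact NatTrans.mono_of_mono_app _

lemma spaceHomologyMap_ι₀_bijective (A : SSet.{u}) (n : ℕ) :
    Function.Bijective (spaceHomologyMap n (SSet.ι₀ : A ⟶ A ⊗ Δ[1])) := by
  refine Function.bijective_iff_has_inverse.2 ⟨spaceHomologyMap n
    (CartesianMonoidalCategory.fst A Δ[1]), fun x ↦ ?_, fun x ↦ ?_⟩
  · rw [← spaceHomologyMap_comp_apply]
    exact spaceHomologyMap_id_apply n x
  · rw [← spaceHomologyMap_comp_apply, spaceHomologyMap, (cylinderHomotopy A).congr_homologyMap]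
    exact spaceHomologyMap_id_apply n x

lemma spaceHomologyMap_ι₀_eq_ι₁ (A : SSet.{u}) (n : ℕ) :
    spaceHomologyMap n (SSet.ι₀ : A ⟶ A ⊗ Δ[1]) = spaceHomologyMap n (SSet.ι₁ : A ⟶ A ⊗ Δ[1]) :=
  congrArg ModuleCat.Hom.hom ((homotopyOfCylinder (𝟙 (A ⊗ Δ[1])) (Category.comp_id _)
    (Category.comp_id _)).congr_homologyMap (ModuleCat.of ZZ.{u} ZZ.{u}) n)

lemma subsingleton_spaceHomology_point (n : ℕ) (hn : 1 ≤ n) :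
    Subsingleton (spaceHomology n (Δ[0] : SSet.{u})) := by
  have h : IsZero (((Δ[0] : SSet.{u}).normalizedChainComplex
      (ModuleCat.of ZZ.{u} ZZ.{u})).homology n) := by
    apply ShortComplex.isZero_homology_of_isZero_X₂
    exact SSet.isZero_normalizedChainComplex_X_of_hasDimensionLT _ _ n 1
  exact ModuleCat.subsingleton_of_isZero (h.of_iso
    (((Δ[0] : SSet.{u}).homotopyEquivNormalizedChainComplex
      (ModuleCat.of ZZ.{u} ZZ.{u})).toHomologyIso n))

lemma homologyMap_comp_apply {X Y Z : ChainComplex (ModuleCat.{u} ZZ.{u}) ℕ} (f : X ⟶ Y)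
    (g : Y ⟶ Z) (n : ℕ) (x : X.homology n) :
    HomologicalComplex.homologyMap (f ≫ g) n x =
      HomologicalComplex.homologyMap g n (HomologicalComplex.homologyMap f n x) := by
  rw [HomologicalComplex.homologyMap_comp]
  rfl

lemma homologyMap_add_apply {X Y : ChainComplex (ModuleCat.{u} ZZ.{u}) ℕ} (f g : X ⟶ Y)
    (n : ℕ) (x : X.homology n) :
    HomologicalComplex.homologyMap (f + g) n x =
      HomologicalComplex.homologyMap f n x + HomologicalComplex.homologyMap g n x := by
  rw [HomologicalComplex.homologyMap_add]
  rfl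

/-- The long exact homology sequence of a short exact sequence of complexes of modules. -/
lemma exists_connectingMap {X Y Z : ChainComplex (ModuleCat.{u} ZZ.{u}) ℕ} (f : X ⟶ Y)
    (g : Y ⟶ Z) (w : f ≫ g = 0) (h : (ShortComplex.mk f g w).ShortExact) :
    ∃ δ : ∀ n, Z.homology (n + 1) ⟶ X.homology n,
      (∀ n, Function.Exact (HomologicalComplex.homologyMap g (n + 1)) (δ n)) ∧
      (∀ n, Function.Exact (δ n) (HomologicalComplex.homologyMap f n)) ∧
      (∀ n, Function.Exact (HomologicalComplex.homologyMap f n)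
        (HomologicalComplex.homologyMap g n)) :=
  ⟨fun n ↦ h.δ (n + 1) n rfl,
    fun n ↦ (ShortComplex.ShortExact.moduleCat_exact_iff_function_exact _).1
      (ShortComplex.ShortExact.homology_exact₃ h (n + 1) n rfl),
    fun n ↦ (ShortComplex.ShortExact.moduleCat_exact_iff_function_exact _).1
      (ShortComplex.ShortExact.homology_exact₁ h (n + 1) n rfl),
    fun n ↦ (ShortComplex.ShortExact.moduleCat_exact_iff_function_exact _).1
      (ShortComplex.ShortExact.homology_exact₂ h n)⟩

/-- The Mayer–Vietoris sequence of a pushout square of chain complexes one of whose legs is a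
monomorphism. -/
lemma mayerVietoris {X₁ X₂ X₃ X₄ : ChainComplex (ModuleCat.{u} ZZ.{u}) ℕ} {t : X₁ ⟶ X₂}
    {l : X₁ ⟶ X₃} {r : X₂ ⟶ X₄} {b : X₃ ⟶ X₄} (sq : IsPushout t l r b) [Mono l] :
    ∃ δ : ∀ n, X₄.homology (n + 1) ⟶ X₁.homology n,
      (∀ n z, δ n z = 0 ↔ ∃ x₂ x₃, z = HomologicalComplex.homologyMap r (n + 1) x₂ +
        HomologicalComplex.homologyMap b (n + 1) x₃) ∧
      (∀ n x, (∃ z, δ n z = x) ↔ HomologicalComplex.homologyMap t n x = 0 ∧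
        HomologicalComplex.homologyMap l n x = 0) ∧
      (∀ n x₂ x₃, HomologicalComplex.homologyMap r n x₂ +
        HomologicalComplex.homologyMap b n x₃ = 0 ↔
          ∃ x, HomologicalComplex.homologyMap t n x = x₂ ∧
            HomologicalComplex.homologyMap l n x = -x₃) := by
  -- the square is encoded in the short exact sequence `X₁ → X₂ ⊞ X₃ → X₄` of maps `(t, -l)` and
  -- `r + b`
  have hmono : Mono (biprod.lift t (-l)) := by
    have : Mono (biprod.lift t (-l) ≫ biprod.snd) := by
      rw [biprod.lift_snd]
      infer_instance
    exact mono_of_mono (biprod.lift t (-l)) biprod.snd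
  obtain ⟨δ, h₁, h₂, h₃⟩ := exists_connectingMap (biprod.lift t (-l)) (biprod.desc r b)
    (by simp [sq.w])
    { exact := sq.exact_shortComplex
      mono_f := hmono
      epi_g := sq.epi_shortComplex_g }
  let fst : X₂ ⊞ X₃ ⟶ X₂ := biprod.fst
  let snd : X₂ ⊞ X₃ ⟶ X₃ := biprod.snd
  let inl : X₂ ⟶ X₂ ⊞ X₃ := biprod.inl
  let inr : X₃ ⟶ X₂ ⊞ X₃ := biprod.inr
  have hfst (n : ℕ) (x : X₁.homology n) :
      HomologicalComplex.homologyMap fst n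
        (HomologicalComplex.homologyMap (biprod.lift t (-l)) n x) =
        HomologicalComplex.homologyMap t n x := by
    rw [← homologyMap_comp_apply, biprod.lift_fst]
  have hsnd (n : ℕ) (x : X₁.homology n) :
      HomologicalComplex.homologyMap snd n
        (HomologicalComplex.homologyMap (biprod.lift t (-l)) n x) =
        - HomologicalComplex.homologyMap l n x := by
    rw [← homologyMap_comp_apply, biprod.lift_snd, HomologicalComplex.homologyMap_neg]
    rfl
  have hg (n : ℕ) (y : (X₂ ⊞ X₃).homology n) :
      HomologicalComplex.homologyMap (biprod.desc r b) n y =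
        HomologicalComplex.homologyMap r n (HomologicalComplex.homologyMap fst n y) +
        HomologicalComplex.homologyMap b n (HomologicalComplex.homologyMap snd n y) := by
    rw [← homologyMap_comp_apply, ← homologyMap_comp_apply, ← homologyMap_add_apply,
      ← biprod.desc_eq]
  have hpair (n : ℕ) (x₂ : X₂.homology n) (x₃ : X₃.homology n) :
      ∃ y : (X₂ ⊞ X₃).homology n,
        HomologicalComplex.homologyMap fst n y = x₂ ∧
        HomologicalComplex.homologyMap snd n y = x₃ := by
    refine ⟨HomologicalComplex.homologyMap inl n x₂ +
      HomologicalComplex.homologyMap inr n x₃, ?_, ?_⟩ <;>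
    · rw [map_add, ← homologyMap_comp_apply, ← homologyMap_comp_apply]
      simp [fst, snd, inl, inr]
  have hinj (n : ℕ) (y y' : (X₂ ⊞ X₃).homology n)
      (h₂ : HomologicalComplex.homologyMap fst n y = HomologicalComplex.homologyMap fst n y')
      (h₃ : HomologicalComplex.homologyMap snd n y = HomologicalComplex.homologyMap snd n y') :
      y = y' := by
    have key (w : (X₂ ⊞ X₃).homology n) : w = HomologicalComplex.homologyMap inl n
          (HomologicalComplex.homologyMap fst n w) + HomologicalComplex.homologyMap inr n
          (HomologicalComplex.homologyMap snd n w) := by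
      rw [← homologyMap_comp_apply, ← homologyMap_comp_apply, ← homologyMap_add_apply,
        show fst ≫ inl + snd ≫ inr = 𝟙 _ from biprod.total]
      simp
    rw [key y, key y', h₂, h₃]
  refine ⟨δ, fun n z ↦ (h₁ n z).trans ⟨?_, ?_⟩, fun n x ↦ (h₂ n x).symm.trans ⟨?_, ?_⟩,
    fun n x₂ x₃ ↦ ?_⟩
  · rintro ⟨y, rfl⟩
    exact ⟨_, _, hg _ y⟩
  · rintro ⟨x₂, x₃, rfl⟩
    obtain ⟨y, rfl, rfl⟩ := hpair _ x₂ x₃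
    exact ⟨y, hg _ y⟩
  · intro h
    have h' := hfst n x
    have h'' := hsnd n x
    rw [h, map_zero] at h' h''
    exact ⟨h'.symm, neg_eq_zero.1 h''.symm⟩
  · rintro ⟨ht, hl⟩
    apply hinj
    · rw [hfst, ht, map_zero]
    · rw [hsnd, hl, map_zero, neg_zero]
  · obtain ⟨y, rfl, rfl⟩ := hpair n x₂ x₃
    rw [← hg, h₃ n y]
    refine exists_congr fun x ↦ ⟨?_, ?_⟩
    · rintro rfl
      rw [hfst, hsnd, neg_neg]
      exact ⟨rfl, rfl⟩
    · rintro ⟨ht, hl⟩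
      apply hinj
      · rw [hfst, ht]
      · rw [hsnd, hl, neg_neg]

/-- The long exact homology sequence of the mapping cone, that is, of the homotopy pushout of
`B ← A → *`. It comes from the Mayer–Vietoris sequence of the gluing of the cylinder along its two
ends, by taking the component of the connecting map at the end `A × {0}`. In degree zero the
sequence would need reduced homology. -/
theorem exists_coneSequence {A B : SSet.{u}} (f : A ⟶ B) :
    ∃ δ : ∀ n, spaceHomology (n + 1) (homotopyPushout f (toPoint A)) →ₗ[ZZ.{u}]
        spaceHomology n A,
      (∀ n, 1 ≤ n → Function.Exact
        (spaceHomologyMap (n + 1) (homotopyPushoutInl f (toPoint A))) (δ n)) ∧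
      (∀ n, 1 ≤ n → Function.Exact (δ n) (spaceHomologyMap n f)) ∧
      (∀ n, 1 ≤ n → Function.Exact (spaceHomologyMap n f)
        (spaceHomologyMap n (homotopyPushoutInl f (toPoint A)))) := by
  have := mono_cylinderEnds A
  let t : A ⨿ A ⟶ B ⨿ (Δ[0] : SSet.{u}) := coprod.map f (toPoint A)
  let l : A ⨿ A ⟶ A ⊗ Δ[1] := coprod.desc SSet.ι₀ SSet.ι₁
  let r : B ⨿ (Δ[0] : SSet.{u}) ⟶ homotopyPushout f (toPoint A) := pushout.inl t l
  let b : A ⊗ Δ[1] ⟶ homotopyPushout f (toPoint A) := pushout.inr t l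
  let i : A ⟶ A ⨿ A := coprod.inl
  let j : A ⟶ A ⨿ A := coprod.inr
  let i' : B ⟶ B ⨿ (Δ[0] : SSet.{u}) := coprod.inl
  let j' : (Δ[0] : SSet.{u}) ⟶ B ⨿ (Δ[0] : SSet.{u}) := coprod.inr
  obtain ⟨δ, h₁, h₂, h₃⟩ : ∃ δ : ∀ n, spaceHomology (n + 1) (homotopyPushout f (toPoint A)) ⟶
        spaceHomology n (A ⨿ A),
      (∀ n z, δ n z = 0 ↔ ∃ x₂ x₃, z = spaceHomologyMap (n + 1) r x₂ +
        spaceHomologyMap (n + 1) b x₃) ∧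
      (∀ n x, (∃ z, δ n z = x) ↔ spaceHomologyMap n t x = 0 ∧ spaceHomologyMap n l x = 0) ∧
      (∀ n x₂ x₃, spaceHomologyMap n r x₂ + spaceHomologyMap n b x₃ = 0 ↔
          ∃ x, spaceHomologyMap n t x = x₂ ∧ spaceHomologyMap n l x = -x₃) := by
    have sq := (IsPushout.of_hasPushout t l).map chainsFunctor
    have : Mono (chainsFunctor.map l) := inferInstance
    exact mayerVietoris sq
  have hl₀ : i ≫ l = SSet.ι₀ := coprod.inl_desc _ _
  have hl₁ : j ≫ l = SSet.ι₁ := coprod.inr_desc _ _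
  have ht₀ : i ≫ t = f ≫ i' := coprod.inl_map _ _
  have ht₁ : j ≫ t = toPoint A ≫ j' := coprod.inr_map _ _
  have hsq : t ≫ r = l ≫ b := pushout.condition
  have hJ : homotopyPushoutInl f (toPoint A) = i' ≫ r := rfl
  have hb₀ : (SSet.ι₀ : A ⟶ A ⊗ Δ[1]) ≫ b = f ≫ homotopyPushoutInl f (toPoint A) := by
    rw [← hl₀, Category.assoc, ← hsq, reassoc_of% ht₀, hJ]
  have hb₁ : (SSet.ι₁ : A ⟶ A ⊗ Δ[1]) ≫ b = toPoint A ≫ j' ≫ r := by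
    rw [← hl₁, Category.assoc, ← hsq, reassoc_of% ht₁]
  choose p q hpi hpj hqi hqj hpq using fun n ↦ spaceHomology_coprod n A A
  choose p' q' hpi' hpj' hqi' hqj' hpq' using fun n ↦ spaceHomology_coprod n B (Δ[0] : SSet.{u})
  -- both ends of the cylinder induce the same isomorphism, so `l` is the sum map in homology
  have hl (n : ℕ) (s : spaceHomology n (A ⨿ A)) : spaceHomologyMap n l s =
      spaceHomologyMap n (SSet.ι₀ : A ⟶ A ⊗ Δ[1]) (p n s + q n s) := by
    conv_lhs => rw [← hpq n s]
    rw [map_add, map_add, ← spaceHomologyMap_comp_apply, ← spaceHomologyMap_comp_apply, hl₀, hl₁,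
      spaceHomologyMap_ι₀_eq_ι₁]
  have hpt (n : ℕ) (hn : 1 ≤ n) (x : spaceHomology n (Δ[0] : SSet.{u})) : x = 0 :=
    (subsingleton_spaceHomology_point n hn).elim _ _
  have ht (n : ℕ) (hn : 1 ≤ n) (s : spaceHomology n (A ⨿ A)) : spaceHomologyMap n t s =
      spaceHomologyMap n i' (spaceHomologyMap n f (p n s)) := by
    conv_lhs => rw [← hpq n s]
    rw [map_add, ← spaceHomologyMap_comp_apply, ← spaceHomologyMap_comp_apply, ht₀, ht₁,
      spaceHomologyMap_comp_apply, spaceHomologyMap_comp_apply,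
      hpt n hn (spaceHomologyMap n (toPoint A) _), map_zero, add_zero]
  have hinj (n : ℕ) := (spaceHomologyMap_ι₀_bijective A n).1
  refine ⟨fun n ↦ (p n).hom ∘ₗ (δ n).hom, fun n hn z ↦ ⟨fun hz ↦ ?_, ?_⟩,
    fun n hn a ↦ ⟨fun ha ↦ ?_, ?_⟩, fun n hn β ↦ ⟨fun hβ ↦ ?_, ?_⟩⟩
  · replace hz : p n (δ n z) = 0 := hz
    have hlz := ((h₂ n (δ n z)).1 ⟨z, rfl⟩).2
    rw [hl, hz, zero_add] at hlz
    have hq : q n (δ n z) = 0 := hinj n (hlz.trans (map_zero _).symm)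
    have hδ : δ n z = 0 := by rw [← hpq n (δ n z), hz, hq, map_zero, map_zero, add_zero]
    obtain ⟨x₂, x₃, rfl⟩ := (h₁ n z).1 hδ
    obtain ⟨a, rfl⟩ := (spaceHomologyMap_ι₀_bijective A (n + 1)).2 x₃
    refine ⟨p' (n + 1) x₂ + spaceHomologyMap (n + 1) f a, ?_⟩
    rw [map_add, ← spaceHomologyMap_comp_apply, ← spaceHomologyMap_comp_apply, hb₀, hJ]
    conv_rhs => rw [← hpq' (n + 1) x₂]
    rw [hpt (n + 1) (by omega) (q' (n + 1) x₂), map_zero, add_zero, ← spaceHomologyMap_comp_apply]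
  · rintro ⟨β, rfl⟩
    have : δ n (spaceHomologyMap (n + 1) (homotopyPushoutInl f (toPoint A)) β) = 0 := by
      refine (h₁ n _).2 ⟨spaceHomologyMap (n + 1) i' β, 0, ?_⟩
      rw [map_zero, add_zero, ← spaceHomologyMap_comp_apply, hJ]
    change p n (δ n _) = 0
    rw [this, map_zero]
  -- a class killed by `f` is hit by the connecting map once it is placed on both ends of the
  -- cylinder with opposite signs
  · obtain ⟨z, hz⟩ := (h₂ n (spaceHomologyMap n i a - spaceHomologyMap n j a)).2 (by
      have hp : p n (spaceHomologyMap n i a - spaceHomologyMap n j a) = a := by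
        rw [map_sub, hpi, hpj, sub_zero]
      have hq : q n (spaceHomologyMap n i a - spaceHomologyMap n j a) = -a := by
        rw [map_sub, hqi, hqj, zero_sub]
      rw [ht n hn, hl, hp, hq, ha, map_zero, add_neg_cancel, map_zero]
      exact ⟨rfl, rfl⟩)
    refine ⟨z, ?_⟩
    change p n (δ n z) = a
    rw [hz, map_sub, hpi, hpj, sub_zero]
  · rintro ⟨z, rfl⟩
    have := ((h₂ n (δ n z)).1 ⟨z, rfl⟩).1
    rw [ht n hn] at this
    exact (hpi' n _).symm.trans ((congrArg (p' n) this).trans (map_zero _))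
  · obtain ⟨s, hs, -⟩ := (h₃ n (spaceHomologyMap n i' β) 0).1 (by
      rw [map_zero, add_zero, ← spaceHomologyMap_comp_apply, ← hJ, hβ])
    refine ⟨p n s, ?_⟩
    rw [ht n hn] at hs
    have := congrArg (p' n) hs
    rwa [hpi', hpi'] at this
  · rintro ⟨a, rfl⟩
    rw [← spaceHomologyMap_comp_apply, ← hb₀, spaceHomologyMap_comp_apply,
      spaceHomologyMap_ι₀_eq_ι₁, ← spaceHomologyMap_comp_apply, hb₁, spaceHomologyMap_comp_apply,
      hpt n hn (spaceHomologyMap n (toPoint A) a), map_zero]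

/-! ### Free chains of simplicial sets -/

/-- The chain complex of the free modules on the simplices of a simplicial set. -/
def freeChains : SSet.{u} ⥤ ChainComplex (ModuleCat.{u} ZZ.{u}) ℕ :=
  (SimplicialObject.whiskering (Type u) (ModuleCat.{u} ZZ.{u})).obj (ModuleCat.free ZZ.{u}) ⋙
    AlgebraicTopology.alternatingFaceMapComplex _

lemma freeChains_d_single (S : SSet.{u}) (n : ℕ) (x : S _⦋n + 1⦌) (c : ZZ.{u}) :
    (freeChains.obj S).d (n + 1) n (Finsupp.single x c : S _⦋n + 1⦌ →₀ ZZ.{u}) =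
      (∑ i : Fin (n + 2), (-1 : ℤ) ^ (i : ℕ) • Finsupp.single (S.δ i x) c : S _⦋n⦌ →₀ ZZ.{u}) := by
  have h : (freeChains.obj S).d (n + 1) n = ∑ i : Fin (n + 2), (-1 : ℤ) ^ (i : ℕ) •
      (ModuleCat.free ZZ.{u}).map (S.δ i) :=
    AlgebraicTopology.AlternatingFaceMapComplex.obj_d_eq _ n
  have h' (t : Finset (Fin (n + 2))) : (∑ i ∈ t, (-1 : ℤ) ^ (i : ℕ) •
      (ModuleCat.free ZZ.{u}).map (S.δ i)).hom (Finsupp.single x c : S _⦋n + 1⦌ →₀ ZZ.{u}) =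
      (∑ i ∈ t, (-1 : ℤ) ^ (i : ℕ) • Finsupp.single (S.δ i x) c : S _⦋n⦌ →₀ ZZ.{u}) := by
    induction t using Finset.cons_induction with
    | empty => rfl
    | cons a t ha ih =>
      rw [Finset.sum_cons, Finset.sum_cons, ← ih]
      exact congrArg₂ (· + ·) (congrArg ((-1 : ℤ) ^ (a : ℕ) • ·)
        (Finsupp.mapDomain_single (f := S.δ a) (a := x) (b := c))) rfl
  exact (congrArg (fun f ↦ f.hom (Finsupp.single x c : S _⦋n + 1⦌ →₀ ZZ.{u})) h).trans (h' _)

lemma freeChains_map_single {S T : SSet.{u}} (f : S ⟶ T) (n : ℕ) (x : S _⦋n⦌) (c : ZZ.{u}) :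
    (freeChains.map f).f n (Finsupp.single x c : S _⦋n⦌ →₀ ZZ.{u}) =
      (Finsupp.single (f.app _ x) c : T _⦋n⦌ →₀ ZZ.{u}) :=
  Finsupp.mapDomain_single

/-- The coproduct of copies of the ring indexed by a set is the free module on it. -/
def sigmaConstIsoFree :
    sigmaConst.obj (ModuleCat.of ZZ.{u} ZZ.{u}) ≅ ModuleCat.free ZZ.{u} :=
  NatIso.ofComponents (fun (X : Type u) ↦
    { hom := Sigma.desc (fun x : X ↦ (ModuleCat.ofHom (Finsupp.lsingle x) :
        ModuleCat.of ZZ.{u} ZZ.{u} ⟶ (ModuleCat.free ZZ.{u}).obj X))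
      inv := ModuleCat.freeDesc (TypeCat.ofHom fun x : X ↦
        (Sigma.ι (fun _ : X ↦ ModuleCat.of ZZ.{u} ZZ.{u}) x) (1 : ZZ.{u}))
      hom_inv_id := by
        refine Sigma.hom_ext _ _ fun x ↦ ?_
        erw [Sigma.ι_desc_assoc]
        ext
        exact (ModuleCat.freeDesc_apply _ x).trans rfl
      inv_hom_id := by
        ext x
        refine (congrArg _ (ModuleCat.freeDesc_apply _ x)).trans ?_
        exact congr($(Sigma.ι_desc (fun x : X ↦ (ModuleCat.ofHom (Finsupp.lsingle x) :
          ModuleCat.of ZZ.{u} ZZ.{u} ⟶ (ModuleCat.free ZZ.{u}).obj X)) x) (1 : ZZ.{u})) })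
    (fun {X Y} f ↦ by
      refine Sigma.hom_ext _ _ fun x ↦ ?_
      refine (Sigma.ι_comp_map'_assoc (f := fun _ : X ↦ ModuleCat.of ZZ.{u} ZZ.{u})
        (g := fun _ : Y ↦ ModuleCat.of ZZ.{u} ZZ.{u}) f (fun _ ↦ 𝟙 _) x _).trans ?_
      rw [Category.id_comp]
      refine (Sigma.ι_desc (fun x : Y ↦ (ModuleCat.ofHom (Finsupp.lsingle x) :
          ModuleCat.of ZZ.{u} ZZ.{u} ⟶ (ModuleCat.free ZZ.{u}).obj Y)) (f x)).trans ?_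
      refine Eq.trans ?_ (Sigma.ι_desc_assoc (fun x : X ↦ (ModuleCat.ofHom (Finsupp.lsingle x) :
          ModuleCat.of ZZ.{u} ZZ.{u} ⟶ (ModuleCat.free ZZ.{u}).obj X)) x _).symm
      refine ModuleCat.hom_ext (LinearMap.ext fun c ↦ ?_)
      exact (Finsupp.mapDomain_single (f := f) (a := x) (b := c)).symm)

/-- The two models of the chains of a simplicial set. -/
def chainsIsoFreeChains : chainsFunctor.{u} ≅ freeChains :=
  Functor.isoWhiskerRight ((SimplicialObject.whiskering _ _).mapIso sigmaConstIsoFree)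
    (AlgebraicTopology.alternatingFaceMapComplex _)

/-! ### The simplices of Eilenberg–MacLane spaces, and group homology -/

section
variable {G : Type u} [Group G]

/-- The simplex of `K(G)` that is the image of the simplex of the universal cover with vertices
`β`. Composition in `SingleObj G` is multiplication in the reverse order, which is why its arrows
are `(β j)⁻¹ * β i`. -/
def kSimplex {n : ℕ} (β : Fin (n + 1) → G) : (eilenbergMacLane G) _⦋n⦌ :=
  show Fin (n + 1) ⥤ SingleObj G from
  { obj := fun _ ↦ SingleObj.star G
    map := fun {i j} _ ↦ ((β j)⁻¹ * β i : G)
    map_id := fun i ↦ inv_mul_cancel (β i)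
    map_comp := fun {i j k} _ _ ↦ show ((β k)⁻¹ * β i : G) = ((β k)⁻¹ * β j) * ((β j)⁻¹ * β i) by
      group }

/-- The arrow from the `i`-th to the `j`-th vertex of a simplex of `K(G)`. -/
def kArrow {n : ℕ} (F : (eilenbergMacLane G) _⦋n⦌) (i j : Fin (n + 1)) (h : i ≤ j) : G :=
  (show Fin (n + 1) ⥤ SingleObj G from F).map (homOfLE h)

lemma kArrow_mul {n : ℕ} (F : (eilenbergMacLane G) _⦋n⦌) {i j k : Fin (n + 1)} (h : i ≤ j)
    (h' : j ≤ k) : kArrow F j k h' * kArrow F i j h = kArrow F i k (h.trans h') :=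
  ((show Fin (n + 1) ⥤ SingleObj G from F).map_comp (homOfLE h) (homOfLE h')).symm

lemma kArrow_kSimplex {n : ℕ} (β : Fin (n + 1) → G) (i j : Fin (n + 1)) (h : i ≤ j) :
  kArrow (kSimplex β) i j h = (β j)⁻¹ * β i := rfl

lemma kArrow_δ {n : ℕ} (F : (eilenbergMacLane G) _⦋n + 1⦌) (k : Fin (n + 2)) (i j : Fin (n + 1))
    (h : i ≤ j) : kArrow ((eilenbergMacLane G).δ k F) i j h =
      kArrow F (k.succAbove i) (k.succAbove j) ((Fin.strictMono_succAbove k).monotone h) := rfl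

lemma kArrow_map {H : Type u} [Group H] (f : G →* H) {n : ℕ} (F : (eilenbergMacLane G) _⦋n⦌)
    (i j : Fin (n + 1)) (h : i ≤ j) :
    kArrow ((eilenbergMacLaneMap f).app _ F) i j h = f (kArrow F i j h) := rfl

lemma kSimplex_ext {n : ℕ} {F F' : (eilenbergMacLane G) _⦋n⦌}
    (h : ∀ i j hij, kArrow F i j hij = kArrow F' i j hij) : F = F' :=
  CategoryTheory.Functor.ext (fun _ ↦ rfl) fun i j f ↦ by
    simp only [eqToHom_refl, Category.comp_id, Category.id_comp]
    exact h i j (leOfHom f)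

lemma eq_kSimplex {n : ℕ} (F : (eilenbergMacLane G) _⦋n⦌) :
    F = kSimplex (fun i ↦ (kArrow F 0 i (Fin.zero_le _))⁻¹) :=
  kSimplex_ext fun i j h ↦ by
    rw [kArrow_kSimplex, inv_inv, ← kArrow_mul F (Fin.zero_le i) h, mul_inv_cancel_right]

lemma kArrow_self {n : ℕ} (F : (eilenbergMacLane G) _⦋n⦌) (i : Fin (n + 1)) (h : i ≤ i) :
    kArrow F i i h = 1 :=
  (show Fin (n + 1) ⥤ SingleObj G from F).map_id i

lemma kArrow_congr {n : ℕ} (F : (eilenbergMacLane G) _⦋n⦌) {i j i' j' : Fin (n + 1)} (h : i ≤ j)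
    (hi : i = i') (hj : j = j') : kArrow F i j h = kArrow F i' j' (hi ▸ hj ▸ h) := by
  subst hi hj
  rfl

lemma partialProd_kArrow {n : ℕ} (F : (eilenbergMacLane G) _⦋n⦌) (i : Fin (n + 1)) :
    Fin.partialProd (fun i : Fin n ↦ (kArrow F i.castSucc i.succ i.castSucc_le_succ)⁻¹) i =
      (kArrow F 0 i (Fin.zero_le _))⁻¹ := by
  induction i using Fin.induction with
  | zero => rw [Fin.partialProd_zero, kArrow_self, inv_one]
  | succ i ih =>
    rw [Fin.partialProd_succ, ih, ← mul_inv_rev, kArrow_mul]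

/-- The simplices of `K(G)` are the tuples of elements of `G`. The inverses turn the reversed
composition of `SingleObj G` into the multiplication of consecutive entries that occurs in the
inhomogeneous chains. -/
def kEquiv (G : Type u) [Group G] (n : ℕ) : (eilenbergMacLane G) _⦋n⦌ ≃ (Fin n → G) where
  toFun F i := (kArrow F i.castSucc i.succ i.castSucc_le_succ)⁻¹
  invFun g := kSimplex (Fin.partialProd g)
  left_inv F := by
    exact (congrArg kSimplex (funext (partialProd_kArrow F))).trans (eq_kSimplex F).symm
  right_inv g := by
    ext i
    change (kArrow (kSimplex (Fin.partialProd g)) _ _ _)⁻¹ = _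
    rw [kArrow_kSimplex, mul_inv_rev, inv_inv, Fin.partialProd_right_inv]

lemma kEquiv_apply {n : ℕ} (F : (eilenbergMacLane G) _⦋n⦌) (i : Fin n) :
    kEquiv G n F i = (kArrow F i.castSucc i.succ i.castSucc_le_succ)⁻¹ := rfl

lemma kEquiv_δ_zero {n : ℕ} (F : (eilenbergMacLane G) _⦋n + 1⦌) :
    kEquiv G n ((eilenbergMacLane G).δ 0 F) = fun i ↦ kEquiv G (n + 1) F i.succ := rfl

lemma kEquiv_δ_succ {n : ℕ} (F : (eilenbergMacLane G) _⦋n + 1⦌) (j : Fin (n + 1)) :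
    kEquiv G n ((eilenbergMacLane G).δ j.succ F) =
      Fin.contractNth j (· * ·) (kEquiv G (n + 1) F) := by
  ext i
  rw [kEquiv_apply, kArrow_δ]
  rcases lt_trichotomy (i : ℕ) j with h | h | h
  · rw [Fin.contractNth_apply_of_lt _ _ _ _ h, kEquiv_apply]
    congr 1
    refine kArrow_congr _ _ ?_ ?_ <;> ext <;> simp [Fin.succAbove, Fin.lt_def] <;>
      (split_ifs <;> (simp; try omega))
  · rw [Fin.contractNth_apply_of_eq _ _ _ _ h, kEquiv_apply, kEquiv_apply, ← mul_inv_rev]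
    congr 1
    refine (kArrow_congr _ _ ?_ ?_).trans (kArrow_mul F (i := i.castSucc.castSucc)
      (j := i.castSucc.succ) (k := i.succ.succ) i.castSucc.castSucc_le_succ
      i.succ.castSucc_le_succ).symm <;>
      ext <;> simp [Fin.succAbove, Fin.lt_def] <;>
      (split_ifs <;> (simp; try omega))
  · rw [Fin.contractNth_apply_of_gt _ _ _ _ h, kEquiv_apply]
    congr 1
    refine kArrow_congr _ _ ?_ ?_ <;> ext <;> simp [Fin.succAbove, Fin.lt_def] <;>
      (split_ifs <;> (simp; try omega))

lemma kEquiv_map {H : Type u} [Group H] (f : G →* H) {n : ℕ} (F : (eilenbergMacLane G) _⦋n⦌) :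
    kEquiv H n ((eilenbergMacLaneMap f).app _ F) = f ∘ kEquiv G n F := by
  ext i
  rw [Function.comp_apply, kEquiv_apply, kEquiv_apply, kArrow_map, map_inv]

/-- The faces of a simplex of `K(G)` correspond to the terms of the differential of the
inhomogeneous chains. -/
lemma inhomogeneousChains_d_mapDomain (n : ℕ) (F : (eilenbergMacLane G) _⦋n + 1⦌) :
    (groupHomology.inhomogeneousChains (Rep.trivial ZZ.{u} G ZZ.{u})).d (n + 1) n
      (Finsupp.mapDomain (kEquiv G (n + 1)) (Finsupp.single F 1) : (Fin (n + 1) → G) →₀ ZZ.{u}) =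
    (Finsupp.mapDomain (kEquiv G n) (∑ i : Fin (n + 2), (-1 : ℤ) ^ (i : ℕ) •
      Finsupp.single ((eilenbergMacLane G).δ i F) (1 : ZZ.{u})) : (Fin n → G) →₀ ZZ.{u}) := by
  rw [Finsupp.mapDomain_single, groupHomology.inhomogeneousChains.d_def]
  refine (groupHomology.inhomogeneousChains.d_single _ _ _).trans ?_
  rw [Fin.sum_univ_succ (n := n + 1), Finsupp.mapDomain_add, Finsupp.mapDomain_finsetSum]
  congr 1
  · rw [Fin.val_zero, pow_zero, one_smul, Finsupp.mapDomain_single, kEquiv_δ_zero]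
    rfl
  · refine Finset.sum_congr rfl fun j _ ↦ ?_
    rw [Finsupp.mapDomain_smul, Finsupp.mapDomain_single, kEquiv_δ_succ, Fin.val_succ,
      Finsupp.smul_single, Finsupp.smul_single]
    congr 1

/-- Group homology is computed by the free chains of the Eilenberg–MacLane space. -/
def freeChainsKIso (G : Type u) [Group G] :
    freeChains.obj (eilenbergMacLane G) ≅
      groupHomology.inhomogeneousChains (Rep.trivial ZZ.{u} G ZZ.{u}) :=
  HomologicalComplex.Hom.isoOfComponents
    (fun n ↦ (Finsupp.domLCongr (kEquiv G n) :
      ((eilenbergMacLane G) _⦋n⦌ →₀ ZZ.{u}) ≃ₗ[ZZ.{u}] ((Fin n → G) →₀ ZZ.{u})).toModuleIso)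
    (by
      rintro _ n rfl
      refine ModuleCat.hom_ext (Finsupp.lhom_ext' fun (F : (eilenbergMacLane G) _⦋n + 1⦌) ↦
        LinearMap.ext_ring ?_)
      have h : (Finsupp.domLCongr (kEquiv G n) :
          ((eilenbergMacLane G) _⦋n⦌ →₀ ZZ.{u}) ≃ₗ[ZZ.{u}] ((Fin n → G) →₀ ZZ.{u}))
          ((freeChains.obj (eilenbergMacLane G)).d (n + 1) n (Finsupp.single F (1 : ZZ.{u}) :
            (eilenbergMacLane G) _⦋n + 1⦌ →₀ ZZ.{u})) = _ :=
        congrArg _ (freeChains_d_single (eilenbergMacLane G) n F 1)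
      refine Eq.trans ?_ h.symm
      refine Eq.trans ?_ ((inhomogeneousChains_d_mapDomain n F).trans ?_)
      · exact congrArg ((groupHomology.inhomogeneousChains
          (Rep.trivial ZZ.{u} G ZZ.{u})).d (n + 1) n)
          ((Finsupp.domLCongr_single (kEquiv G (n + 1)) F (1 : ZZ.{u})).trans
            Finsupp.mapDomain_single.symm)
      · exact (Finsupp.equivMapDomain_eq_mapDomain (kEquiv G n) _).symm)

lemma freeChainsKIso_naturality {H : Type u} [Group H] (f : G →* H) :
    freeChains.map (eilenbergMacLaneMap f) ≫ (freeChainsKIso H).hom =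
      (freeChainsKIso G).hom ≫ groupHomology.chainsMap (A := Rep.trivial ZZ.{u} G ZZ.{u})
        (B := Rep.trivial ZZ.{u} H ZZ.{u}) f (𝟙 (Rep.trivial ZZ.{u} G ZZ.{u})) := by
  ext n : 1
  refine ModuleCat.hom_ext (Finsupp.lhom_ext' fun (F : (eilenbergMacLane G) _⦋n⦌) ↦
    LinearMap.ext_ring ?_)
  have h₁ : (Finsupp.domLCongr (kEquiv H n) :
      ((eilenbergMacLane H) _⦋n⦌ →₀ ZZ.{u}) ≃ₗ[ZZ.{u}] ((Fin n → H) →₀ ZZ.{u}))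
      ((freeChains.map (eilenbergMacLaneMap f)).f n (Finsupp.single F (1 : ZZ.{u}) :
        (eilenbergMacLane G) _⦋n⦌ →₀ ZZ.{u})) = Finsupp.single (f ∘ kEquiv G n F) 1 :=
    (congrArg _ (freeChains_map_single (eilenbergMacLaneMap f) n F 1)).trans
      ((Finsupp.domLCongr_single (kEquiv H n) _ _).trans (by rw [kEquiv_map]))
  refine Eq.trans h₁ ?_
  exact ((congrArg ((groupHomology.chainsMap (A := Rep.trivial ZZ.{u} G ZZ.{u})
        (B := Rep.trivial ZZ.{u} H ZZ.{u}) f (𝟙 (Rep.trivial ZZ.{u} G ZZ.{u}))).f n)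
      (Finsupp.domLCongr_single (kEquiv G n) F (1 : ZZ.{u}))).trans
        (groupHomology.chainsMap_f_single _ _ _ _ _)).symm

/-- Group homology is the homology of the Eilenberg–MacLane space. -/
def grpHomologyEquiv (n : ℕ) (G : Type u) [Group G] :
    grpHomology n G ≃ₗ[ZZ.{u}] spaceHomology n (eilenbergMacLane G) :=
  (HomologicalComplex.homologyMapIso ((freeChainsKIso G).symm ≪≫
    chainsIsoFreeChains.symm.app (eilenbergMacLane G)) n).toLinearEquiv

lemma grpHomologyEquiv_naturality (n : ℕ) {H : Type u} [Group H] (f : G →* H) :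
    (grpHomologyEquiv n H).toLinearMap ∘ₗ grpHomologyMap n f =
      spaceHomologyMap n (eilenbergMacLaneMap f) ∘ₗ (grpHomologyEquiv n G).toLinearMap := by
  have h := freeChainsKIso_naturality f
  rw [← Iso.eq_comp_inv, Category.assoc, ← Iso.inv_comp_eq] at h
  have h' := chainsIsoFreeChains.inv.naturality (eilenbergMacLaneMap f)
  have h'' : groupHomology.chainsMap (A := Rep.trivial ZZ.{u} G ZZ.{u})
        (B := Rep.trivial ZZ.{u} H ZZ.{u}) f (𝟙 (Rep.trivial ZZ.{u} G ZZ.{u})) ≫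
      (freeChainsKIso H).inv ≫ chainsIsoFreeChains.inv.app (eilenbergMacLane H) =
      ((freeChainsKIso G).inv ≫ chainsIsoFreeChains.inv.app (eilenbergMacLane G)) ≫
        chainsFunctor.map (eilenbergMacLaneMap f) := by
    rw [Category.assoc, ← h', reassoc_of% h]
  have := congr(HomologicalComplex.homologyMap $h'' n)
  rw [HomologicalComplex.homologyMap_comp _ ((freeChainsKIso H).inv ≫ _),
    HomologicalComplex.homologyMap_comp _ (chainsFunctor.map _)] at this
  exact congr(($this).hom)

end

/-! ### Double complexes -/

/-- A sequence built by dependent choice: `P` is the invariant of the construction and `r` relates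
consecutive terms. -/
lemma exists_seq_of_step {α : ℕ → Type*} {P : ∀ n, α n → Prop} {r : ∀ n, α n → α (n + 1) → Prop}
    (a : α 0) (ha : P 0 a) (h : ∀ n a, P n a → ∃ b, r n a b ∧ P (n + 1) b) :
    ∃ s : ∀ n, α n, s 0 = a ∧ ∀ n, r n (s n) (s (n + 1)) := by
  choose t ht using h
  let s : ∀ n, {a : α n // P n a} := fun n ↦
    Nat.rec ⟨a, ha⟩ (fun n x ↦ ⟨t n x.1 x.2, (ht n x.1 x.2).2⟩) n
  exact ⟨fun n ↦ (s n).1, rfl, fun n ↦ (ht n _ (s n).2).1⟩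

/-- A first-quadrant double complex of modules, with anticommuting squares. -/
structure DoubleComplex (R : Type*) [Ring R] where
  /-- The terms. -/
  X : ℕ → ℕ → Type u
  [addCommGroup : ∀ p q, AddCommGroup (X p q)]
  [module : ∀ p q, Module R (X p q)]
  /-- The horizontal differential. -/
  dh : ∀ p q, X (p + 1) q →ₗ[R] X p q
  /-- The vertical differential. -/
  dv : ∀ p q, X p (q + 1) →ₗ[R] X p q
  dh_dh : ∀ p q x, dh p q (dh (p + 1) q x) = 0
  dv_dv : ∀ p q x, dv p q (dv p (q + 1) x) = 0
  dh_dv : ∀ p q x, dh p q (dv (p + 1) q x) = - dv p q (dh p (q + 1) x)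

attribute [instance] DoubleComplex.addCommGroup DoubleComplex.module

namespace DoubleComplex

variable {R : Type*} [Ring R]

/-- The total differential, on families of elements of all bidegrees. Families are not required
to have finite support; the homology of the total complex is taken after restriction to the finitely
many bidegrees of a given total degree. -/
def dTot (D : DoubleComplex.{u} R) : (∀ p q, D.X p q) →ₗ[R] (∀ p q, D.X p q) :=
  LinearMap.pi fun p ↦ LinearMap.pi fun q ↦
    D.dh p q ∘ₗ LinearMap.proj q ∘ₗ LinearMap.proj (p + 1) +
      D.dv p q ∘ₗ LinearMap.proj (q + 1) ∘ₗ LinearMap.proj p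

variable (D : DoubleComplex.{u} R)

/-- The component of bidegree `(p, q)`. -/
def component (p q : ℕ) : (∀ p q, D.X p q) →ₗ[R] D.X p q where
  toFun x := x p q
  map_add' _ _ := rfl
  map_smul' _ _ := rfl

lemma dTot_apply (x : ∀ p q, D.X p q) (p q : ℕ) :
    D.dTot x p q = D.dh p q (x (p + 1) q) + D.dv p q (x p (q + 1)) := rfl

/-- The elements of total degree `n`. -/
def degree (n : ℕ) : Submodule R (∀ p q, D.X p q) where
  carrier := {x | ∀ p q, p + q ≠ n → x p q = 0}
  add_mem' {x y} hx hy p q h := by simp [hx p q h, hy p q h]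
  zero_mem' _ _ _ := rfl
  smul_mem' c x hx p q h := by simp [hx p q h]

/-- The cycles of total degree `n`. -/
def cycles (n : ℕ) : Submodule R (∀ p q, D.X p q) := D.degree n ⊓ LinearMap.ker D.dTot

/-- The boundaries of total degree `n`. -/
def boundaries (n : ℕ) : Submodule R (∀ p q, D.X p q) := (D.degree (n + 1)).map D.dTot

/-- The part of total degree `n`. -/
def truncate (n : ℕ) (x : ∀ p q, D.X p q) (p q : ℕ) : D.X p q := if p + q = n then x p q else 0

lemma truncate_mem (n : ℕ) (x : ∀ p q, D.X p q) : D.truncate n x ∈ D.degree n :=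
  fun _ _ h ↦ if_neg h

lemma truncate_eq (n : ℕ) {x : ∀ p q, D.X p q} (hx : x ∈ D.degree n) : D.truncate n x = x := by
  funext p q
  unfold truncate
  split_ifs with h
  · rfl
  · exact (hx p q h).symm

lemma dTot_truncate (n : ℕ) (x : ∀ p q, D.X p q) :
    D.dTot (D.truncate (n + 1) x) = D.truncate n (D.dTot x) := by
  funext p q
  rw [dTot_apply]
  unfold truncate
  have h₁ : p + 1 + q = n + 1 ↔ p + q = n := by omega
  have h₂ : p + (q + 1) = n + 1 ↔ p + q = n := by omega
  simp only [h₁, h₂]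
  split_ifs
  · rfl
  · simp

lemma dTot_truncate_zero (x : ∀ p q, D.X p q) : D.dTot (D.truncate 0 x) = 0 := by
  funext p q
  rw [dTot_apply]
  unfold truncate
  rw [if_neg (by omega), if_neg (by omega)]
  simp

lemma mem_boundaries {n : ℕ} {x : ∀ p q, D.X p q} (hx : x ∈ D.degree n)
    {y : ∀ p q, D.X p q} (hy : D.dTot y = x) : x ∈ D.boundaries n :=
  ⟨_, D.truncate_mem (n + 1) y, by rw [dTot_truncate, hy, truncate_eq D n hx]⟩

lemma truncate_mem_cycles (n : ℕ) {x : ∀ p q, D.X p q} (hx : D.dTot x = 0) :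
    D.truncate n x ∈ D.cycles n := by
  refine ⟨D.truncate_mem n x, ?_⟩
  cases n with
  | zero => exact D.dTot_truncate_zero x
  | succ n =>
    refine (D.dTot_truncate n x).trans ?_
    rw [hx]
    funext p q
    exact ite_self _

/-- Columns that resolve a complex: a family `x` annihilated by the total differential, whose
augmentation is the boundary of `e`, is a boundary of a family lifting `e`. -/
lemma exists_lift_of_columns {E : ℕ → Type*} [∀ p, AddCommGroup (E p)] [∀ p, Module R (E p)]
    (dE : ∀ p, E (p + 1) →ₗ[R] E p) (ε : ∀ p, D.X p 0 →ₗ[R] E p)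
    (hε : ∀ p x, ε p (D.dh p 0 x) = dE p (ε (p + 1) x))
    (hs : ∀ p, Function.Surjective (ε p))
    (h₀ : ∀ p x, ε p x = 0 → ∃ y, D.dv p 0 y = x)
    (h₁ : ∀ p q x, D.dv p q x = 0 → ∃ y, D.dv p (q + 1) y = x)
    (x : ∀ p q, D.X p q) (hx : D.dTot x = 0) (e : ∀ p, E p)
    (hxe : ∀ p, ε p (x p 0) = dE p (e (p + 1))) :
    ∃ y, D.dTot y = x ∧ ∀ p, ε p (y p 0) = e p := by
  choose s hs using hs
  obtain ⟨y, hy₀, hy⟩ := exists_seq_of_step (α := fun q ↦ ∀ p, D.X p q)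
    (P := fun q a ↦ ∀ p, ∃ b, D.dv p q b = x p q - D.dh p q (a (p + 1)))
    (r := fun q a b ↦ ∀ p, D.dv p q (b p) = x p q - D.dh p q (a (p + 1))) (fun p ↦ s p (e p))
    (fun p ↦ h₀ p _ (by rw [map_sub, hε, hs, hxe, sub_self]))
    (fun q a ha ↦ by
      choose b hb using ha
      refine ⟨b, hb, fun p ↦ h₁ p q _ ?_⟩
      have hx' := congrFun₂ hx p q
      rw [dTot_apply, Pi.zero_apply, Pi.zero_apply] at hx'
      have h := D.dh_dv p q (b (p + 1))
      rw [hb, map_sub, D.dh_dh, sub_zero] at h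
      rw [map_sub, sub_eq_add_neg, ← h, add_comm, hx'])
  refine ⟨fun p q ↦ y q p, ?_, fun p ↦ (congrArg (ε p) (congrFun hy₀ p)).trans (hs p _)⟩
  funext p q
  rw [dTot_apply, hy, add_sub_cancel]

/-- Lifting through a map `f : D → D'` that satisfies a lifting condition on rows: a family `x`
annihilated by the total differential, whose image is the boundary of `y'`, is the boundary of a
family lifting `y'`. The family is found by induction on the horizontal degree. -/
lemma exists_lift_of_rows {D D' : DoubleComplex.{u} R} (f : ∀ p q, D.X p q →ₗ[R] D'.X p q)
    (hv : ∀ p q x, f p q (D.dv p q x) = D'.dv p q (f p (q + 1) x))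
    (hs : ∀ q, Function.Surjective (f 0 q))
    (h₀ : ∀ q x y', f 0 q x = D'.dh 0 q y' → ∃ y, D.dh 0 q y = x ∧ f 1 q y = y')
    (h₁ : ∀ p q x y', D.dh p q x = 0 → f (p + 1) q x = D'.dh (p + 1) q y' →
      ∃ y, D.dh (p + 1) q y = x ∧ f (p + 2) q y = y')
    (x : ∀ p q, D.X p q) (hx : D.dTot x = 0) (y' : ∀ p q, D'.X p q)
    (hxy : ∀ p q, f p q (x p q) = D'.dTot y' p q) :
    ∃ y, D.dTot y = x ∧ ∀ p q, f p q (y p q) = y' p q := by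
  choose s hs using hs
  obtain ⟨y, hy₀, hy⟩ := exists_seq_of_step (α := fun p ↦ ∀ q, D.X p q)
    (P := fun p a ↦ (∀ q, f p q (a q) = y' p q) ∧
      ∀ q, ∃ b, D.dh p q b = x p q - D.dv p q (a (q + 1)) ∧ f (p + 1) q b = y' (p + 1) q)
    (r := fun p a b ↦ (∀ q, f p q (a q) = y' p q) ∧
      ∀ q, D.dh p q (b q) = x p q - D.dv p q (a (q + 1))) (fun q ↦ s q (y' 0 q))
    ⟨fun q ↦ hs q _, fun q ↦ h₀ q _ _ (by rw [map_sub, hv, hs, hxy, dTot_apply]; abel)⟩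
    (fun p a ha ↦ by
      obtain ⟨ha₁, ha₂⟩ := ha
      choose b hb using ha₂
      refine ⟨b, ⟨ha₁, fun q ↦ (hb q).1⟩, fun q ↦ (hb q).2, fun q ↦ h₁ p q _ _ ?_ ?_⟩
      · have hx' := congrFun₂ hx p q
        rw [dTot_apply, Pi.zero_apply, Pi.zero_apply] at hx'
        have h := D.dh_dv p q (b (q + 1))
        rw [(hb _).1, map_sub (D.dv p q), D.dv_dv, sub_zero] at h
        rw [map_sub, h, sub_neg_eq_add, hx']
      · rw [map_sub, hv, (hb _).2, hxy, dTot_apply]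
        abel)
  refine ⟨y, ?_, fun p q ↦ (hy p).1 q⟩
  funext p q
  rw [dTot_apply, (hy p).2, sub_add_cancel]

end DoubleComplex

/-! ### Homology classes of cycles -/

section HomologyClass

variable {R : Type u} [Ring R]

/-- The cycles of a chain complex of modules, as a submodule. In degree zero the truncated
subtraction gives the differential from `0` to `0`, which vanishes. -/
abbrev cycleSubmodule (C : ChainComplex (ModuleCat.{u} R) ℕ) (n : ℕ) : Submodule R (C.X n) :=
  LinearMap.ker (C.d n (n - 1)).hom

lemma d_pred_comp (C : ChainComplex (ModuleCat.{u} R) ℕ) (n : ℕ) :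
    ModuleCat.ofHom (cycleSubmodule C n).subtype ≫ C.d n (n - 1) = 0 := by
  ext x
  exact x.2

lemma next_eq_pred (n : ℕ) : (ComplexShape.down ℕ).next n = n - 1 := by
  cases n <;> simp

/-- A cycle in the submodule of cycles, as an element of the object of cycles. -/
def toCycles (C : ChainComplex (ModuleCat.{u} R) ℕ) (n : ℕ) :
    cycleSubmodule C n →ₗ[R] C.cycles n :=
  (C.liftCycles (ModuleCat.ofHom (cycleSubmodule C n).subtype) (n - 1) (next_eq_pred n)
    (d_pred_comp C n)).hom

lemma iCycles_toCycles (C : ChainComplex (ModuleCat.{u} R) ℕ) (n : ℕ) (x : cycleSubmodule C n) :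
    C.iCycles n (toCycles C n x) = x :=
  congr($(C.liftCycles_i (ModuleCat.ofHom (cycleSubmodule C n).subtype) (n - 1)
    (next_eq_pred n) (d_pred_comp C n)) x)

lemma iCycles_injective (C : ChainComplex (ModuleCat.{u} R) ℕ) (n : ℕ) :
    Function.Injective (C.iCycles n) :=
  (ModuleCat.mono_iff_injective (C.iCycles n)).1 inferInstance

/-- The homology class of a cycle. -/
def homologyClass (C : ChainComplex (ModuleCat.{u} R) ℕ) (n : ℕ) :
    cycleSubmodule C n →ₗ[R] C.homology n :=
  (C.homologyπ n).hom ∘ₗ toCycles C n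

lemma d_mem_cycleSubmodule (C : ChainComplex (ModuleCat.{u} R) ℕ) (n : ℕ) (y : C.X (n + 1)) :
    C.d (n + 1) n y ∈ cycleSubmodule C n :=
  congr($(C.d_comp_d (n + 1) n (n - 1)) y)

lemma homologyClass_surjective (C : ChainComplex (ModuleCat.{u} R) ℕ) (n : ℕ) :
    Function.Surjective (homologyClass C n) := by
  intro h
  obtain ⟨z, rfl⟩ := (ModuleCat.epi_iff_surjective (C.homologyπ n)).1 inferInstance h
  refine ⟨⟨C.iCycles n z, congr($(C.iCycles_d n (n - 1)) z)⟩, ?_⟩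
  refine congrArg (C.homologyπ n) (iCycles_injective C n ?_)
  exact iCycles_toCycles C n ⟨C.iCycles n z, _⟩

lemma homologyClass_eq_zero_iff (C : ChainComplex (ModuleCat.{u} R) ℕ) (n : ℕ)
    (x : cycleSubmodule C n) : homologyClass C n x = 0 ↔ ∃ y, C.d (n + 1) n y = x := by
  have h := (ShortComplex.moduleCat_exact_iff _).1
    (ShortComplex.exact_of_g_is_cokernel (ShortComplex.mk (C.toCycles (n + 1) n) (C.homologyπ n)
      (C.toCycles_comp_homologyπ (n + 1) n)) (C.homologyIsCokernel (n + 1) n (by simp)))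
  have hi (y : C.X (n + 1)) : C.iCycles n (C.toCycles (n + 1) n y) = C.d (n + 1) n y :=
    congr($(C.toCycles_i (n + 1) n) y)
  refine ⟨fun hx ↦ ?_, fun ⟨y, hy⟩ ↦ ?_⟩
  · obtain ⟨y, hy⟩ := h (toCycles C n x) hx
    refine ⟨y, (hi y).symm.trans ?_⟩
    rw [← iCycles_toCycles]
    exact congrArg (C.iCycles n) hy
  · have : toCycles C n x = C.toCycles (n + 1) n y :=
      iCycles_injective C n (by rw [iCycles_toCycles, hi, hy])
    change C.homologyπ n (toCycles C n x) = 0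
    rw [this]
    exact congr($(C.toCycles_comp_homologyπ (n + 1) n) y)

lemma homologyMap_homologyClass {C C' : ChainComplex (ModuleCat.{u} R) ℕ} (f : C ⟶ C') (n : ℕ)
    (x : cycleSubmodule C n) (y : cycleSubmodule C' n) (hx : f.f n x = y) :
    HomologicalComplex.homologyMap f n (homologyClass C n x) = homologyClass C' n y := by
  have h₁ : HomologicalComplex.homologyMap f n (C.homologyπ n (toCycles C n x)) =
      C'.homologyπ n (HomologicalComplex.cyclesMap f n (toCycles C n x)) :=
    congr($(HomologicalComplex.homologyπ_naturality f n) (toCycles C n x))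
  have h₂ : C'.iCycles n (HomologicalComplex.cyclesMap f n (toCycles C n x)) =
      f.f n (C.iCycles n (toCycles C n x)) :=
    congr($(HomologicalComplex.cyclesMap_i f n) (toCycles C n x))
  refine h₁.trans (congrArg (C'.homologyπ n) (iCycles_injective C' n ?_))
  rw [h₂, iCycles_toCycles, iCycles_toCycles, hx]

end HomologyClass

namespace DoubleComplex
variable {R : Type u} [Ring R] (D : DoubleComplex.{u} R)

/-- If the columns of a double complex resolve a complex, the homology of that complex is the
homology of the total complex. -/
lemma exists_classMap_of_columns (C : ChainComplex (ModuleCat.{u} R) ℕ)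
    (ε : ∀ p, D.X p 0 →ₗ[R] C.X p)
    (hε : ∀ p x, ε p (D.dh p 0 x) = C.d (p + 1) p (ε (p + 1) x))
    (hv : ∀ p x, ε p (D.dv p 0 x) = 0)
    (hs : ∀ p, Function.Surjective (ε p))
    (h₀ : ∀ p x, ε p x = 0 → ∃ y, D.dv p 0 y = x)
    (h₁ : ∀ p q x, D.dv p q x = 0 → ∃ y, D.dv p (q + 1) y = x) (n : ℕ) :
    ∃ π : D.cycles n →+ C.homology n, Function.Surjective π ∧
      ∀ x, π x = 0 ↔ (x : ∀ p q, D.X p q) ∈ D.boundaries n := by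
  have hc (x : D.cycles n) : ε n (x.1 n 0) ∈ cycleSubmodule C n := by
    cases n with
    | zero => exact congr($(C.shape 0 0 (by simp)) _)
    | succ n =>
      have hx' := congrFun₂ x.2.2 n 0
      rw [dTot_apply] at hx'
      have h := congrArg (ε n) hx'
      rw [map_add, hv, add_zero] at h
      exact (hε n (x.1 (n + 1) 0)).symm.trans (h.trans (map_zero _))
  refine ⟨(homologyClass C n ∘ₗ LinearMap.codRestrict _
    (ε n ∘ₗ D.component n 0 ∘ₗ (D.cycles n).subtype) hc).toAddMonoidHom, fun h ↦ ?_, fun x ↦ ?_⟩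
  · obtain ⟨e, rfl⟩ := homologyClass_surjective C n h
    obtain ⟨y, hy, hye⟩ := D.exists_lift_of_columns (fun p ↦ (C.d (p + 1) p).hom) ε hε hs h₀ h₁ 0
      (map_zero _) (Function.update 0 n e.1) (fun p ↦ by
        by_cases hp : p + 1 = n
        · subst hp
          rw [Function.update_self]
          exact (map_zero (ε p)).trans e.2.symm
        · rw [Function.update_of_ne hp]
          exact (map_zero (ε p)).trans (map_zero _).symm)
    refine ⟨⟨_, D.truncate_mem_cycles n hy⟩, congrArg (homologyClass C n) (Subtype.ext ?_)⟩
    refine Eq.trans ?_ ((hye n).trans (Function.update_self ..))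
    exact congrArg (ε n) (if_pos rfl)
  · refine (homologyClass_eq_zero_iff C n _).trans ⟨fun ⟨e, he⟩ ↦ ?_, fun ⟨y, hy, hyx⟩ ↦ ?_⟩
    · obtain ⟨y, hy, -⟩ := D.exists_lift_of_columns (fun p ↦ (C.d (p + 1) p).hom) ε hε hs h₀ h₁
        x.1 x.2.2 (Function.update 0 (n + 1) e) (fun p ↦ by
          by_cases hp : p = n
          · subst hp
            rw [Function.update_self]
            exact he.symm
          · rw [Function.update_of_ne (by omega), x.2.1 p 0 hp]
            exact (map_zero (ε p)).trans (map_zero _).symm)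
      exact D.mem_boundaries x.2.1 hy
    · refine ⟨ε (n + 1) (y (n + 1) 0), (hε _ _).symm.trans ?_⟩
      change _ = ε n (x.1 n 0)
      rw [← hyx, dTot_apply, map_add, hv, add_zero]

/-- A map of double complexes whose rows satisfy the conditions `hs`, `h₀` and `h₁`, which say that
it is surjective and a quasi-isomorphism on rows, identifies the homologies of the total
complexes. -/
lemma cycles_of_rows {D D' : DoubleComplex.{u} R} (f : ∀ p q, D.X p q →ₗ[R] D'.X p q)
    (hh : ∀ p q x, f p q (D.dh p q x) = D'.dh p q (f (p + 1) q x))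
    (hv : ∀ p q x, f p q (D.dv p q x) = D'.dv p q (f p (q + 1) x))
    (hs : ∀ q, Function.Surjective (f 0 q))
    (h₀ : ∀ q x y', f 0 q x = D'.dh 0 q y' → ∃ y, D.dh 0 q y = x ∧ f 1 q y = y')
    (h₁ : ∀ p q x y', D.dh p q x = 0 → f (p + 1) q x = D'.dh (p + 1) q y' →
      ∃ y, D.dh (p + 1) q y = x ∧ f (p + 2) q y = y') (n : ℕ) :
    ∃ F : D.cycles n →+ D'.cycles n, Function.Surjective F ∧
      ∀ x, (F x : ∀ p q, D'.X p q) ∈ D'.boundaries n ↔ (x : ∀ p q, D.X p q) ∈ D.boundaries n := by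
  let F : (∀ p q, D.X p q) →ₗ[R] (∀ p q, D'.X p q) :=
    LinearMap.pi fun p ↦ LinearMap.pi fun q ↦ f p q ∘ₗ LinearMap.proj q ∘ₗ LinearMap.proj p
  have hF (x) : D'.dTot (F x) = F (D.dTot x) := by
    funext p q
    exact (congrArg₂ (· + ·) (hh p q _).symm (hv p q _).symm).trans (map_add (f p q) _ _).symm
  have hd {m x} (hx : x ∈ D.degree m) : F x ∈ D'.degree m := fun p q h ↦
    (congrArg (f p q) (hx p q h)).trans (map_zero _)
  have hc (x) (hx : x ∈ D.cycles n) : F x ∈ D'.cycles n :=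
    ⟨hd hx.1, (hF x).trans ((congrArg F hx.2).trans (map_zero F))⟩
  refine ⟨(LinearMap.restrict F hc).toAddMonoidHom, fun z ↦ ?_, fun x ↦ ⟨?_, ?_⟩⟩
  · obtain ⟨y, hy, hyz⟩ := exists_lift_of_rows f hv hs h₀ h₁ 0 (map_zero _) z.1 (fun p q ↦ by
      rw [z.2.2]
      exact map_zero _)
    refine ⟨⟨_, D.truncate_mem_cycles n hy⟩, Subtype.ext ?_⟩
    refine Eq.trans ?_ (D'.truncate_eq n z.2.1)
    funext p q
    change f p q (D.truncate n y p q) = D'.truncate n z.1 p q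
    unfold truncate
    split_ifs
    · exact hyz p q
    · exact map_zero _
  · rintro ⟨y', hy', hxy⟩
    obtain ⟨y, hy, -⟩ := exists_lift_of_rows f hv hs h₀ h₁ x.1 x.2.2 y' (fun p q ↦ by
      rw [hxy]
      rfl)
    exact D.mem_boundaries x.2.1 hy
  · rintro ⟨y, hy, hyx⟩
    exact ⟨F y, hd hy, (hF y).trans (congrArg F hyx)⟩

/-- The double complex of a complex of chain complexes; the signs make its squares
anticommute. -/
def ofColumns (C : ℕ → ChainComplex (ModuleCat.{u} R) ℕ) (φ : ∀ p, C (p + 1) ⟶ C p)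
    (hφ : ∀ p, φ (p + 1) ≫ φ p = 0) : DoubleComplex.{u} R where
  X p q := (C p).X q
  dh p q := ((φ p).f q).hom
  dv p q := (-1 : ℤ) ^ p • ((C p).d (q + 1) q).hom
  dh_dh p q x := congr(($(hφ p)).f q x)
  dv_dv p q x := by
    rw [LinearMap.smul_apply, LinearMap.smul_apply, map_zsmul]
    have h : ((C p).d (q + 1) q).hom (((C p).d (q + 1 + 1) (q + 1)).hom x) = 0 :=
      congr($((C p).d_comp_d (q + 2) (q + 1) q) x)
    rw [h, smul_zero, smul_zero]
  dh_dv p q x := by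
    rw [LinearMap.smul_apply, LinearMap.smul_apply, map_zsmul, pow_succ, mul_neg_one, neg_smul]
    have h : ((φ p).f q).hom (((C (p + 1)).d (q + 1) q).hom x) =
      ((C p).d (q + 1) q).hom (((φ p).f (q + 1)).hom x) := congr($((φ p).comm (q + 1) q) x).symm
    rw [h]

lemma ofColumns_map_dv {C C' : ℕ → ChainComplex (ModuleCat.{u} R) ℕ} {φ : ∀ p, C (p + 1) ⟶ C p}
    {hφ : ∀ p, φ (p + 1) ≫ φ p = 0} {φ' : ∀ p, C' (p + 1) ⟶ C' p}
    {hφ' : ∀ p, φ' (p + 1) ≫ φ' p = 0} (f : ∀ p, C p ⟶ C' p) (p q : ℕ) (x : (C p).X (q + 1)) :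
    ((f p).f q).hom ((ofColumns C φ hφ).dv p q x) =
      (ofColumns C' φ' hφ').dv p q (((f p).f (q + 1)).hom x) :=
  (map_zsmul _ _ _).trans
    (congrArg ((-1 : ℤ) ^ p • ·) congr($((f p).comm (q + 1) q) x).symm)

lemma neg_one_pow_smul_eq_zero {M : Type*} [AddCommGroup M] (p : ℕ) (x : M) :
    (-1 : ℤ) ^ p • x = 0 ↔ x = 0 := by
  rcases neg_one_pow_eq_or ℤ p with h | h <;> simp [h]

/-- The homology of degree three of the total complex, when the horizontal differential
vanishes. -/
lemma exists_classMap_of_dh_eq_zero (C : ℕ → ChainComplex (ModuleCat.{u} R) ℕ) :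
    ∃ π : (ofColumns C 0 fun _ ↦ zero_comp).cycles 3 →+
      (C 0).homology 3 × (C 1).homology 2 × (C 2).homology 1 × (C 3).homology 0,
      Function.Surjective π ∧
      ∀ x, π x = 0 ↔ x.1 ∈ (ofColumns C 0 fun _ ↦ zero_comp).boundaries 3 := by
  set D := ofColumns C 0 fun _ ↦ zero_comp
  have hD (x : ∀ p q, (C p).X q) (p q : ℕ) :
      D.dTot x p q = (-1 : ℤ) ^ p • (C p).d (q + 1) q (x p (q + 1)) := zero_add _
  have hc (p q : ℕ) (x : D.cycles 3) : x.1 p q ∈ cycleSubmodule (C p) q := by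
    cases q with
    | zero => exact congr($((C p).shape 0 0 (by simp)) _)
    | succ q =>
      have hx' := congrFun₂ x.2.2 p q
      exact (neg_one_pow_smul_eq_zero p _).1 ((hD x.1 p q).symm.trans hx')
  let c (p q : ℕ) : D.cycles 3 →ₗ[R] (C p).homology q :=
    homologyClass (C p) q ∘ₗ LinearMap.codRestrict (cycleSubmodule (C p) q)
      (D.component p q ∘ₗ (D.cycles 3).subtype) (hc p q)
  have hc₀ (p q : ℕ) (x : D.cycles 3) : c p q x = 0 ↔ ∃ y, (C p).d (q + 1) q y = x.1 p q :=
    homologyClass_eq_zero_iff _ _ _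
  -- a cycle in a single bidegree is a cycle of the total complex
  have hsingle (p q : ℕ) (h : p + q = 3) (z : cycleSubmodule (C p) q) :
      ∃ x : D.cycles 3, c p q x = homologyClass (C p) q z ∧
        ∀ p' q', p' ≠ p → c p' q' x = 0 := by
    let x : ∀ p q, (C p).X q := Function.update 0 p (Function.update 0 q z.1)
    have hx₁ : x p q = z.1 := by simp [x]
    have hx₂ (p' q' : ℕ) (h : p' ≠ p) : x p' q' = 0 := by simp [x, Function.update_of_ne h]
    have hx₃ (q' : ℕ) (h : q' ≠ q) : x p q' = 0 := by simp [x, Function.update_of_ne h]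
    have hx : x ∈ D.cycles 3 := by
      refine ⟨fun p' q' h' ↦ ?_, funext₂ fun p' q' ↦ (hD _ _ _).trans ?_⟩
      · by_cases hp : p' = p
        · subst hp
          exact hx₃ _ (by omega)
        · exact hx₂ _ _ hp
      · refine (neg_one_pow_smul_eq_zero _ _).2 ?_
        by_cases hp : p' = p
        · subst hp
          by_cases hq : q' + 1 = q
          · subst hq
            rw [hx₁]
            exact z.2
          · rw [hx₃ _ hq]
            exact map_zero _
        · rw [hx₂ _ _ hp]
          exact map_zero _
    refine ⟨⟨x, hx⟩, congrArg (homologyClass (C p) q) (Subtype.ext hx₁), fun p' q' h ↦ ?_⟩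
    exact (hc₀ p' q' _).2 ⟨0, (map_zero _).trans (hx₂ p' q' h).symm⟩
  refine ⟨((c 0 3).prod ((c 1 2).prod ((c 2 1).prod (c 3 0)))).toAddMonoidHom, ?_, fun x ↦ ?_⟩
  · rintro ⟨h₀, h₁, h₂, h₃⟩
    obtain ⟨z₀, rfl⟩ := homologyClass_surjective _ _ h₀
    obtain ⟨z₁, rfl⟩ := homologyClass_surjective _ _ h₁
    obtain ⟨z₂, rfl⟩ := homologyClass_surjective _ _ h₂
    obtain ⟨z₃, rfl⟩ := homologyClass_surjective _ _ h₃
    obtain ⟨x₀, h₀, h₀'⟩ := hsingle 0 3 rfl z₀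
    obtain ⟨x₁, h₁, h₁'⟩ := hsingle 1 2 rfl z₁
    obtain ⟨x₂, h₂, h₂'⟩ := hsingle 2 1 rfl z₂
    obtain ⟨x₃, h₃, h₃'⟩ := hsingle 3 0 rfl z₃
    refine ⟨x₀ + x₁ + x₂ + x₃, ?_⟩
    simp [h₀, h₁, h₂, h₃, h₀', h₁', h₂', h₃']
  · have h : (c 0 3).prod ((c 1 2).prod ((c 2 1).prod (c 3 0))) x = 0 ↔
        c 0 3 x = 0 ∧ c 1 2 x = 0 ∧ c 2 1 x = 0 ∧ c 3 0 x = 0 := by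
      simp [Prod.ext_iff]
    refine h.trans ⟨fun ⟨h₀, h₁, h₂, h₃⟩ ↦ ?_, fun ⟨y, hy, hyx⟩ ↦ ?_⟩
    · have hy (p q : ℕ) : ∃ y, (C p).d (q + 1) q y = x.1 p q := by
        by_cases hpq : p + q = 3
        · rw [← hc₀]
          obtain ⟨rfl, rfl⟩ | ⟨rfl, rfl⟩ | ⟨rfl, rfl⟩ | ⟨rfl, rfl⟩ :
            p = 0 ∧ q = 3 ∨ p = 1 ∧ q = 2 ∨ p = 2 ∧ q = 1 ∨ p = 3 ∧ q = 0 := by omega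
          all_goals assumption
        · exact ⟨0, (map_zero _).trans (x.2.1 p q hpq).symm⟩
      choose y hy using hy
      refine D.mem_boundaries x.2.1
        (y := fun p q ↦ Nat.rec (0 : (C p).X 0) (fun q _ ↦ (-1 : ℤ) ^ p • y p q) q)
        (funext₂ fun p q ↦ (hD _ _ _).trans ?_)
      change (-1 : ℤ) ^ p • (C p).d (q + 1) q ((-1 : ℤ) ^ p • y p q) = _
      rw [map_zsmul, smul_smul, ← mul_pow, neg_one_mul, neg_neg, one_pow, one_smul, hy]
    · have key (p q : ℕ) : c p q x = 0 := by
        refine (hc₀ _ _ _).2 ⟨(-1 : ℤ) ^ p • y p (q + 1), ?_⟩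
        exact (map_zsmul ((C p).d (q + 1) q).hom _ _).trans
          ((hD y p q).symm.trans (congrFun₂ hyx p q))
      exact ⟨key _ _, key _ _, key _ _, key _ _⟩

end DoubleComplex

/-! ### The universal cover of `K(B)` -/

section
variable (B : Type u) [Group B]

/-- The total space of the universal cover of `K(B)`: its `n`-simplices are the
`(n + 1)`-tuples of elements of `B`. -/
def cover : SSet.{u} where
  obj n := Fin (n.unop.len + 1) → B
  map f := TypeCat.ofHom fun x i ↦ x (f.unop.toOrderHom i)

variable {B}

/-- The deck transformations. -/
def coverAct (b : B) : cover B ⟶ cover B where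
  app n := TypeCat.ofHom fun x i ↦ b * x i

lemma coverAct_one : coverAct (1 : B) = 𝟙 _ := by
  ext n x
  exact funext fun i ↦ one_mul _

lemma coverAct_mul (a b : B) : coverAct (a * b) = coverAct b ≫ coverAct a := by
  ext n x
  exact funext fun i ↦ mul_assoc _ _ _

/-- The covering map. -/
def coverProj : cover B ⟶ eilenbergMacLane B where
  app n := TypeCat.ofHom fun x ↦ kSimplex (n := n.unop.len) x

lemma coverAct_coverProj (b : B) : coverAct b ≫ coverProj = coverProj := by
  ext n x
  refine kSimplex_ext (n := n.unop.len) fun i j h ↦ ?_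
  change (b * x j)⁻¹ * (b * x i) = (x j)⁻¹ * x i
  group

variable (S : SSet.{u}) (B)

/-- The chains of `S × E`, where `E` is the universal cover of `K(B)`, as representations
of `B`. -/
def coverRep (p : ℕ) : Rep.{u} ZZ.{u} B :=
  Rep.of (X := (freeChains.obj (S ⊗ cover B)).X p)
    { toFun := fun b : B ↦ ((freeChains.map (S ◁ coverAct b)).f p).hom
      map_one' := by
        rw [coverAct_one, MonoidalCategory.whiskerLeft_id, CategoryTheory.Functor.map_id]
        rfl
      map_mul' := fun a b ↦ by
        rw [coverAct_mul, MonoidalCategory.whiskerLeft_comp, CategoryTheory.Functor.map_comp]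
        rfl }

/-- The differential of the chains of `S × E`, as a map of representations. -/
def coverRepD (p : ℕ) : coverRep B S (p + 1) ⟶ coverRep B S p :=
  Rep.ofHom ⟨((freeChains.obj (S ⊗ cover B)).d (p + 1) p).hom, fun b ↦
    congr(($((freeChains.map (S ◁ coverAct b)).comm (p + 1) p)).hom)⟩

lemma coverRepD_comp (p : ℕ) : coverRepD B S (p + 1) ≫ coverRepD B S p = 0 := by
  refine Rep.hom_ext (Representation.IntertwiningMap.ext (LinearMap.ext fun x ↦ ?_))
  exact congr($((freeChains.obj (S ⊗ cover B)).d_comp_d (p + 2) (p + 1) p) x)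

/-- The double complex computing the homology of `S × K(B)` through the homology of `B` with
coefficients in the chains of `S × E`. -/
def coverDouble : DoubleComplex.{u} ZZ.{u} :=
  .ofColumns (fun p ↦ groupHomology.inhomogeneousChains (coverRep B S p))
    (fun p ↦ groupHomology.chainsMap (MonoidHom.id B) (coverRepD B S p))
    (fun p ↦ by
      rw [← groupHomology.chainsMap_id_comp, coverRepD_comp, groupHomology.chainsMap_zero])

variable {B S}

/-- The simplex of `S × E` in the same orbit, whose second component begins with `1`. -/
def normalize {p : ℕ} (x : S _⦋p⦌ × (Fin (p + 1) → B)) : S _⦋p⦌ × (Fin (p + 1) → B) :=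
  (x.1, fun i ↦ (x.2 0)⁻¹ * x.2 i)

/-- A simplex of `S × E`, as an element of the free module on the simplices. -/
def coverSingle {p : ℕ} (x : S _⦋p⦌ × (Fin (p + 1) → B)) : coverRep B S p :=
  (Finsupp.single x 1 : S _⦋p⦌ × (Fin (p + 1) → B) →₀ ZZ.{u})

lemma coverRep_ρ_coverSingle {p : ℕ} (b : B) (x : S _⦋p⦌ × (Fin (p + 1) → B)) :
    (coverRep B S p).ρ b (coverSingle x) = coverSingle (x.1, fun i ↦ b * x.2 i) :=
  freeChains_map_single (S ◁ coverAct b) p x 1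

lemma coverRep_lhom_ext {p : ℕ} {M : Type*} [AddCommGroup M] [Module ZZ.{u} M]
    {f g : coverRep B S p →ₗ[ZZ.{u}] M} (h : ∀ x, f (coverSingle x) = g (coverSingle x)) :
    f = g :=
  Finsupp.lhom_ext' fun x ↦ LinearMap.ext_ring (h x)

/-- The contraction of the columns of the double complex. As `B` acts freely on the simplices of
`S × E`, the chains of `S × E` are induced from the trivial group; a simplex `x` is the translate by
`x.2 0` of its normalization, and the contraction records this element in front. -/
def coverContraction (p q : ℕ) :
    ((Fin q → B) →₀ coverRep B S p) →ₗ[ZZ.{u}] ((Fin (q + 1) → B) →₀ coverRep B S p) :=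
  Finsupp.lsum ZZ.{u} fun g ↦ show (S _⦋p⦌ × (Fin (p + 1) → B) →₀ ZZ.{u}) →ₗ[ZZ.{u}] _ from
    Finsupp.lsum ZZ.{u} fun x ↦ LinearMap.toSpanSingleton ZZ.{u} _
      (Finsupp.single (Fin.cons (x.2 0)⁻¹ g) (coverSingle (normalize x)))

lemma coverContraction_single (p q : ℕ) (g : Fin q → B) (x : S _⦋p⦌ × (Fin (p + 1) → B)) :
    coverContraction p q (Finsupp.single g (coverSingle x)) =
      Finsupp.single (Fin.cons (x.2 0)⁻¹ g) (coverSingle (normalize x)) := by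
  refine (Finsupp.lsum_single ..).trans ((Finsupp.lsum_single ..).trans ?_)
  rw [LinearMap.toSpanSingleton_apply, one_smul]

lemma normalize_translate {p : ℕ} (b : B) (x : S _⦋p⦌ × (Fin (p + 1) → B)) :
    normalize (x.1, fun i ↦ b * x.2 i) = normalize x := by
  refine Prod.ext rfl (funext fun i ↦ ?_)
  change (b * x.2 0)⁻¹ * (b * x.2 i) = (x.2 0)⁻¹ * x.2 i
  group

variable (B S) in
/-- The differential of the columns of the double complex, without sign. -/
def columnD (p q : ℕ) :
    ((Fin (q + 1) → B) →₀ coverRep B S p) →ₗ[ZZ.{u}] ((Fin q → B) →₀ coverRep B S p) :=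
  (groupHomology.inhomogeneousChains.d (coverRep B S p) q).hom

lemma columnD_single (p q : ℕ) (g : Fin (q + 1) → B) (x : S _⦋p⦌ × (Fin (p + 1) → B)) :
    columnD B S p q (Finsupp.single g (coverSingle x)) =
      Finsupp.single (fun i ↦ g i.succ) (coverSingle (x.1, fun i ↦ (g 0)⁻¹ * x.2 i)) +
        ∑ j : Fin (q + 1), (-1 : ZZ.{u}) ^ ((j : ℕ) + 1) •
          Finsupp.single (Fin.contractNth j (· * ·) g) (coverSingle x) :=
  (groupHomology.inhomogeneousChains.d_single q g (coverSingle x)).trans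
    (by rw [coverRep_ρ_coverSingle]; rfl)

lemma contractNth_succ_cons {q : ℕ} (j : Fin (q + 1)) (b : B) (g : Fin (q + 1) → B) :
    Fin.contractNth j.succ (· * ·) (Fin.cons b g : Fin (q + 2) → B) =
      Fin.cons b (Fin.contractNth j (· * ·) g) := by
  ext i
  refine Fin.cases ?_ (fun i ↦ ?_) i
  · rw [Fin.contractNth_apply_of_lt _ _ _ _ (by simp)]
    rfl
  · rcases lt_trichotomy (i : ℕ) j with h | h | h
    · rw [Fin.contractNth_apply_of_lt _ _ _ _ (by simpa using h), Fin.cons_succ,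
        Fin.contractNth_apply_of_lt _ _ _ _ h]
      rfl
    · rw [Fin.contractNth_apply_of_eq _ _ _ _ (by simpa using h), Fin.cons_succ, Fin.cons_succ,
        Fin.contractNth_apply_of_eq _ _ _ _ h]
      rfl
    · rw [Fin.contractNth_apply_of_gt _ _ _ _ (by simpa using h), Fin.cons_succ, Fin.cons_succ,
        Fin.contractNth_apply_of_gt _ _ _ _ h]

lemma contractNth_zero_cons {q : ℕ} (b : B) (g : Fin (q + 1) → B) :
    Fin.contractNth 0 (· * ·) (Fin.cons b g : Fin (q + 2) → B) =
      Fin.cons (b * g 0) fun i ↦ g i.succ := by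
  ext i
  refine Fin.cases ?_ (fun i ↦ ?_) i
  · rw [Fin.contractNth_apply_of_eq _ _ _ _ (by simp)]
    rfl
  · rw [Fin.contractNth_apply_of_gt _ _ _ _ (by simp)]
    rfl

lemma translate_normalize {p : ℕ} (x : S _⦋p⦌ × (Fin (p + 1) → B)) :
    ((normalize x).1, fun i ↦ ((x.2 0)⁻¹)⁻¹ * (normalize x).2 i) = x :=
  Prod.ext rfl (funext fun i ↦
    (congrArg (· * _) (inv_inv (x.2 0))).trans (mul_inv_cancel_left (x.2 0) (x.2 i)))

lemma columnD_coverContraction_succ (p q : ℕ) (y : (Fin (q + 1) → B) →₀ coverRep B S p) :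
    columnD B S p (q + 1) (coverContraction p (q + 1) y) +
      coverContraction p q (columnD B S p q y) = y := by
  suffices h : columnD B S p (q + 1) ∘ₗ coverContraction p (q + 1) +
      coverContraction p q ∘ₗ columnD B S p q = LinearMap.id from congr($h y)
  refine Finsupp.lhom_ext' fun g ↦ coverRep_lhom_ext fun x ↦ ?_
  change columnD B S p (q + 1)
      (coverContraction p (q + 1) (Finsupp.single g (coverSingle x))) + coverContraction p q
        (columnD B S p q (Finsupp.single g (coverSingle x))) =
          Finsupp.single g (coverSingle x)
  rw [coverContraction_single, columnD_single, columnD_single,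
    map_add, map_sum, coverContraction_single, normalize_translate,
    Fin.sum_univ_succ (n := q + 1), contractNth_zero_cons]
  rw [Fin.cons_zero, translate_normalize]
  simp only [map_smul, coverContraction_single, contractNth_succ_cons,
    Fin.cons_succ, Fin.val_succ, pow_succ _ (_ + 1), mul_neg_one, neg_smul,
    Finset.sum_neg_distrib, mul_inv_rev, inv_inv, Fin.val_zero, zero_add, pow_one, one_smul]
  abel

variable (B S) in
/-- The augmentation of the columns of the double complex, onto the chains of `S × K(B)`. -/
def columnAug (p : ℕ) : ((Fin 0 → B) →₀ coverRep B S p) →ₗ[ZZ.{u}]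
    (freeChains.obj (S ⊗ eilenbergMacLane B)).X p :=
  Finsupp.lsum ℕ fun _ ↦ ((freeChains.map (S ◁ coverProj)).f p).hom

lemma columnAug_coverSingle (p : ℕ) (g : Fin 0 → B) (x : S _⦋p⦌ × (Fin (p + 1) → B)) :
    columnAug B S p (Finsupp.single g (coverSingle x)) =
      (Finsupp.single (x.1, kSimplex x.2) 1 :
        S _⦋p⦌ × (eilenbergMacLane B) _⦋p⦌ →₀ ZZ.{u}) :=
  (Finsupp.lsum_single ℕ (fun _ ↦ ((freeChains.map (S ◁ coverProj)).f p).hom) g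
    (coverSingle x)).trans (freeChains_map_single (S ◁ coverProj) p x 1)

variable (B S) in
/-- A section of the augmentation of the columns of the double complex, which lifts simplices of
`K(B)` to simplices of `E` beginning with `1`. -/
def columnSection (p : ℕ) : (freeChains.obj (S ⊗ eilenbergMacLane B)).X p →ₗ[ZZ.{u}]
    ((Fin 0 → B) →₀ coverRep B S p) :=
  show (S _⦋p⦌ × (eilenbergMacLane B) _⦋p⦌ →₀ ZZ.{u}) →ₗ[ZZ.{u}] _ from
    Finsupp.lsum ℕ fun x ↦ LinearMap.toSpanSingleton ZZ.{u} _
      (Finsupp.single 1 (coverSingle (x.1, fun i ↦ (kArrow x.2 0 i (Fin.zero_le _))⁻¹)))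

lemma columnSection_single (p : ℕ) (x : S _⦋p⦌ × (eilenbergMacLane B) _⦋p⦌) :
    columnSection B S p (Finsupp.single x 1 : S _⦋p⦌ × (eilenbergMacLane B) _⦋p⦌ →₀ ZZ.{u}) =
      Finsupp.single 1 (coverSingle (x.1, fun i ↦ (kArrow x.2 0 i (Fin.zero_le _))⁻¹)) := by
  refine (Finsupp.lsum_single ..).trans ?_
  rw [LinearMap.toSpanSingleton_apply, one_smul]

lemma columnAug_columnSection (p : ℕ) (y : (freeChains.obj (S ⊗ eilenbergMacLane B)).X p) :
    columnAug B S p (columnSection B S p y) = y := by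
  suffices h : columnAug B S p ∘ₗ columnSection B S p = LinearMap.id from congr($h y)
  refine Finsupp.lhom_ext' fun (x : S _⦋p⦌ × (eilenbergMacLane B) _⦋p⦌) ↦ LinearMap.ext_ring ?_
  refine (congrArg (columnAug B S p) (columnSection_single p x)).trans ?_
  rw [columnAug_coverSingle, ← eq_kSimplex]
  rfl

lemma columnD_coverContraction_zero (p : ℕ) (y : (Fin 0 → B) →₀ coverRep B S p) :
    columnD B S p 0 (coverContraction p 0 y) = y - columnSection B S p (columnAug B S p y) := by
  suffices h : columnD B S p 0 ∘ₗ coverContraction p 0 =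
      LinearMap.id - columnSection B S p ∘ₗ columnAug B S p from congr($h y)
  refine Finsupp.lhom_ext' fun g ↦ coverRep_lhom_ext fun x ↦ ?_
  change columnD B S p 0 (coverContraction p 0 (Finsupp.single g (coverSingle x))) =
    Finsupp.single g (coverSingle x) - columnSection B S p
      (columnAug B S p (Finsupp.single g (coverSingle x)))
  have hx' : (x.1, fun i ↦ (kArrow (kSimplex x.2) 0 i (Fin.zero_le _))⁻¹) = normalize x :=
    Prod.ext rfl (funext fun i ↦ by
      change (kArrow (kSimplex x.2) 0 i (Fin.zero_le _))⁻¹ = (x.2 0)⁻¹ * x.2 i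
      rw [kArrow_kSimplex, mul_inv_rev, inv_inv])
  rw [columnAug_coverSingle, columnSection_single, hx', coverContraction_single, columnD_single,
    Fin.cons_zero, translate_normalize, Fin.sum_univ_one,
    Subsingleton.elim (Fin.contractNth 0 _ _) (1 : Fin 0 → B), sub_eq_add_neg]
  simp

end

/-! ### Modules over the integers, and hereditary rings -/

/-- The scalar action of `ZZ` is determined by addition. It is stated for an arbitrary module
structure, because several that are not definitionally equal can be inferred for the same group. -/
lemma zz_smul {M : Type*} [AddCommGroup M] [inst : Module ZZ.{u} M] (c : ZZ.{u}) (x : M) :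
    inst.toSMul.smul c x = c.down • x := by
  have h : c = c.down • (1 : ZZ.{u}) := by ext; simp
  refine (congrArg (fun c ↦ inst.toSMul.smul c x) h).trans ?_
  let f : ZZ.{u} →+ M := (@LinearMap.toSpanSingleton ZZ.{u} M _ _ inst x).toAddMonoidHom
  exact (map_zsmul f c.down 1).trans (congrArg _ (@one_smul ZZ.{u} M _ inst.toMulAction x))

/-- An additive map of modules over `ZZ` is linear, for any module structures. -/
def toZZLinear {M N : Type*} [AddCommGroup M] [AddCommGroup N] [instM : Module ZZ.{u} M]
    [instN : Module ZZ.{u} N] (f : M →+ N) : @LinearMap ZZ.{u} ZZ.{u} _ _ (RingHom.id _) M N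
      _ _ instM instN :=
  @LinearMap.mk ZZ.{u} ZZ.{u} _ _ (RingHom.id _) M N _ _ instM instN f.toAddHom fun c x ↦
    ((congrArg f (zz_smul c x)).trans (map_zsmul f c.down x)).trans (zz_smul c (f x)).symm

/-- A ring is hereditary if submodules of projective modules over it are projective. -/
def IsHereditary (R : Type u) [Ring R] : Prop :=
  ∀ (P : Type u) [AddCommGroup P] [Module R P] [Module.Projective R P] (N : Submodule R P),
    Module.Projective R N

/-- A ring is hereditary if its free modules embed in modules all of whose quotients are
injective: for a submodule `N` of a projective module and a surjection `f` from a free module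
`F ⊆ I` onto `N`, the map `N → F / ker f → I / ker f` extends to the projective module, and there lifts to
`I`, which gives a section of `f`. -/
lemma isHereditary_of_embedding {R : Type u} [Ring R]
    (h : ∀ α : Type u, ∃ (I : Type u) (_ : AddCommGroup I) (_ : Module R I)
      (i : (α →₀ R) →ₗ[R] I), Function.Injective i ∧
        ∀ K : Submodule R I, Module.Injective R (I ⧸ K)) : IsHereditary R := by
  intro P _ _ _ N
  refine .of_lifting_property'' fun f hf ↦ ?_
  obtain ⟨I, _, _, i, hi, hI⟩ := h N
  let K := (LinearMap.ker f).map i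
  have hK : Function.Surjective K.mkQ := K.mkQ_surjective
  have hker : LinearMap.ker f ≤ LinearMap.ker (K.mkQ ∘ₗ i) := fun x hx ↦
    (Submodule.Quotient.mk_eq_zero K).2 ⟨x, hx, rfl⟩
  let g : N →ₗ[R] (I ⧸ K) := ((LinearMap.ker f).liftQ (K.mkQ ∘ₗ i) hker) ∘ₗ
      (f.quotKerEquivOfSurjective hf).symm.toLinearMap
  have hg (x) : g (f x) = K.mkQ (i x) := by
    have : (f.quotKerEquivOfSurjective hf).symm (f x) = Submodule.Quotient.mk x :=
      (LinearEquiv.symm_apply_eq _).2 rfl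
    exact congrArg ((LinearMap.ker f).liftQ (K.mkQ ∘ₗ i) hker) this
  obtain ⟨h, hh⟩ := (hI K).out N.subtype N.subtype_injective g
  obtain ⟨l, hl⟩ := Module.projective_lifting_property K.mkQ h hK
  have key (n : N) : ∃ y, i y = l n ∧ f y = n := by
    obtain ⟨x, rfl⟩ := hf n
    have h₁ : K.mkQ (l (f x)) = K.mkQ (i x) :=
      (congr($hl (f x).1)).trans ((hh (f x)).trans (hg x))
    obtain ⟨k, hk, hkx⟩ := (Submodule.Quotient.eq K).1 h₁
    exact ⟨k + x, by rw [map_add, hkx, sub_add_cancel], by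
      rw [map_add, LinearMap.mem_ker.1 hk, zero_add]⟩
  choose s hs₁ hs₂ using key
  refine ⟨⟨⟨s, fun a b ↦ hi ?_⟩, fun c a ↦ hi ?_⟩, LinearMap.ext hs₂⟩
  · rw [map_add, hs₁, hs₁, hs₁, Submodule.coe_add, map_add]
  · rw [map_smul, hs₁, RingHom.id_apply, hs₁, Submodule.coe_smul, map_smul]

/-- Divisible abelian groups are injective. -/
lemma injective_of_divisible {I : Type u} [AddCommGroup I] [inst : Module ZZ.{u} I]
    (h : ∀ (n : ℤ) (x : I), n ≠ 0 → ∃ y, n • y = x) : @Module.Injective ZZ.{u} _ I _ inst where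
  out X Y _ _ _ _ f hf g := by
    choose d hd using h
    let : DivisibleBy I ℤ :=
      { div x n := if hn : n = 0 then 0 else d n x hn
        div_zero x := dif_pos rfl
        div_cancel {n} x hn := by rw [dif_neg hn, hd] }
    obtain ⟨h, hh⟩ := Module.Baer.extension_property_addMonoidHom
      (Module.Baer.of_divisible I) f.toAddMonoidHom hf g.toAddMonoidHom
    exact ⟨toZZLinear h, fun x ↦ congr($hh x)⟩

/-- Free abelian groups embed in rational vector spaces, which are divisible together with all
their quotients. -/
lemma isHereditary_zz : IsHereditary ZZ.{u} := by
  refine isHereditary_of_embedding fun α ↦ ?_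
  refine ⟨α →₀ ULift.{u} ℚ, inferInstance, inferInstance, toZZLinear
    (Finsupp.mapRange.addMonoidHom (AddEquiv.ulift.symm.toAddMonoidHom.comp
      ((Int.castAddHom ℚ).comp AddEquiv.ulift.toAddMonoidHom))), ?_, fun K ↦ ?_⟩
  · exact Finsupp.mapRange_injective _ (map_zero _)
      (ULift.up_injective.comp (Int.cast_injective.comp ULift.down_injective))
  · refine injective_of_divisible fun n x hn ↦ ?_
    obtain ⟨x, rfl⟩ := K.mkQ_surjective x
    refine ⟨K.mkQ ((n : ℚ)⁻¹ • x), ?_⟩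
    rw [← map_zsmul, ← Int.cast_smul_eq_zsmul ℚ, smul_smul, mul_inv_cancel₀ (Int.cast_ne_zero.2 hn),
      one_smul]

/-- In a complex of projective modules over a hereditary ring, the cycles are direct summands. -/
lemma exists_cycleRetraction {R : Type u} [Ring R] (hR : IsHereditary R)
    (C : ChainComplex (ModuleCat.{u} R) ℕ) (n : ℕ) [Module.Projective R (C.X (n - 1))] :
    ∃ r : C.X n →ₗ[R] cycleSubmodule C n, ∀ z : cycleSubmodule C n, r z = z := by
  have := hR _ (LinearMap.range (C.d n (n - 1)).hom)
  obtain ⟨s, hs⟩ := Module.projective_lifting_property (C.d n (n - 1)).hom.rangeRestrict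
    LinearMap.id (C.d n (n - 1)).hom.surjective_rangeRestrict
  have hs' (x : C.X n) : (C.d n (n - 1)).hom (s ((C.d n (n - 1)).hom.rangeRestrict x)) =
    (C.d n (n - 1)).hom x := congr(($hs ((C.d n (n - 1)).hom.rangeRestrict x)).1)
  refine ⟨LinearMap.codRestrict _ (LinearMap.id - s ∘ₗ (C.d n (n - 1)).hom.rangeRestrict)
    fun x ↦ ?_, fun z ↦ Subtype.ext ?_⟩
  · rw [LinearMap.mem_ker, LinearMap.sub_apply, map_sub, LinearMap.comp_apply, hs',
      LinearMap.id_apply, sub_self]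
  · have : (C.d n (n - 1)).hom.rangeRestrict z.1 = 0 := Subtype.ext z.2
    change z.1 - s ((C.d n (n - 1)).hom.rangeRestrict z.1) = z.1
    rw [this, map_zero, sub_zero]

/-! ### The double complex of a product with an Eilenberg–MacLane space -/

section
variable (B : Type u) [Group B] (S : SSet.{u})

/-- The section of the projection `S × E → S` through the vertex `1` of `E`. -/
def coverInclusion : S ⟶ S ⊗ cover B where
  app n := TypeCat.ofHom fun s ↦ (s, fun _ ↦ (1 : B))

/-- The contraction of `E` to the vertex `1`. -/
def coverContractionHomotopy : SSet.Homotopy (𝟙 (S ⊗ cover B))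
    (CartesianMonoidalCategory.fst S (cover B) ≫ coverInclusion B S) := by
  refine homotopyOfCylinder (X := S ⊗ cover B)
    { app n := TypeCat.ofHom fun x ↦ (x.1.1, fun i ↦
        if SSet.stdSimplex.asOrderHom x.2 i = 0 then x.1.2 i else (1 : B))
      naturality n m f := by
        ext ⟨⟨a, s⟩, t⟩
        rfl } ?_ ?_
  · ext n ⟨a, s⟩
    · rfl
    · refine funext fun i ↦ ?_
      change (if (0 : Fin 2) = 0 then s i else 1) = s i
      exact if_pos rfl
  · ext n ⟨a, s⟩
    · rfl
    · refine funext fun i ↦ ?_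
      change (if (1 : Fin 2) = 0 then s i else 1) = 1
      exact if_neg (by decide)

lemma homologyMap_freeChains_eq_of_homotopy {S T : SSet.{u}} {f g : S ⟶ T} (h : SSet.Homotopy f g)
    (n : ℕ) : HomologicalComplex.homologyMap (freeChains.map f) n =
      HomologicalComplex.homologyMap (freeChains.map g) n := by
  have hf := chainsIsoFreeChains.inv.naturality f
  have hg := chainsIsoFreeChains.inv.naturality g
  have h' : HomologicalComplex.homologyMap (chainsFunctor.map f) n =
    HomologicalComplex.homologyMap (chainsFunctor.map g) n :=
      h.congr_homologyMap (ModuleCat.of ZZ.{u} ZZ.{u}) n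
  rw [← cancel_mono (HomologicalComplex.homologyMap (chainsIsoFreeChains.inv.app T) n),
    ← HomologicalComplex.homologyMap_comp, ← HomologicalComplex.homologyMap_comp, hf, hg,
    HomologicalComplex.homologyMap_comp, HomologicalComplex.homologyMap_comp, h']

lemma homologyMap_fst_injective (n : ℕ) : Function.Injective (HomologicalComplex.homologyMap
    (freeChains.map (CartesianMonoidalCategory.fst S (cover B))) n) := by
  have h := homologyMap_freeChains_eq_of_homotopy (coverContractionHomotopy B S) n
  rw [CategoryTheory.Functor.map_id, HomologicalComplex.homologyMap_id, Functor.map_comp,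
    HomologicalComplex.homologyMap_comp] at h
  exact Function.LeftInverse.injective fun x ↦ congr($h x).symm

instance (n : ℕ) : Module.Projective ZZ.{u} ((freeChains.obj S).X n) :=
  inferInstanceAs (Module.Projective ZZ.{u} (S _⦋n⦌ →₀ ZZ.{u}))

/-- A projection of the chains of `S` onto the cycles gives a map from the chains of `S × E` to the
homology of `S`, with zero differential, that is invariant under `B`. On cycles it is the class in
the homology of `S`, which is that of `S × E`. This map exists on all chains because subgroups of
free abelian groups are free. -/
lemma exists_rowClass (n : ℕ) : ∃ φ : coverRep B S n →ₗ[ZZ.{u}] (freeChains.obj S).homology n,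
    (∀ b x, φ ((coverRep B S n).ρ b x) = φ x) ∧
    (∀ x, φ ((freeChains.obj (S ⊗ cover B)).d (n + 1) n x) = 0) ∧
    (∀ c, ∃ z : cycleSubmodule (freeChains.obj (S ⊗ cover B)) n, φ z.1 = c) ∧
    ∀ x : cycleSubmodule (freeChains.obj (S ⊗ cover B)) n, φ x.1 = 0 →
      ∃ y, (freeChains.obj (S ⊗ cover B)).d (n + 1) n y = x.1 := by
  let π := freeChains.map (CartesianMonoidalCategory.fst S (cover B))
  let s := freeChains.map (coverInclusion B S)
  obtain ⟨r, hr⟩ := exists_cycleRetraction isHereditary_zz (freeChains.obj S) n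
  have hπ (x : cycleSubmodule (freeChains.obj (S ⊗ cover B)) n) :
      π.f n x.1 ∈ cycleSubmodule (freeChains.obj S) n := by
    refine congr($(π.comm n (n - 1)) x.1).trans ((congrArg (π.f (n - 1)) x.2).trans (map_zero _))
  have hs (x : cycleSubmodule (freeChains.obj S) n) :
      s.f n x.1 ∈ cycleSubmodule (freeChains.obj (S ⊗ cover B)) n := by
    refine congr($(s.comm n (n - 1)) x.1).trans ((congrArg (s.f (n - 1)) x.2).trans (map_zero _))
  have hsπ : s ≫ π = 𝟙 _ := by
    rw [← Functor.map_comp, ← CategoryTheory.Functor.map_id]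
    rfl
  have hcls (x : cycleSubmodule (freeChains.obj (S ⊗ cover B)) n) :
      homologyClass _ n (r (π.f n x.1)) =
        HomologicalComplex.homologyMap π n (homologyClass _ n x) :=
    (congrArg (homologyClass _ n) (hr ⟨_, hπ x⟩)).trans
      (homologyMap_homologyClass π n x ⟨_, hπ x⟩ rfl).symm
  refine ⟨homologyClass _ n ∘ₗ r ∘ₗ (π.f n).hom, fun b x ↦ ?_, fun x ↦ ?_, fun c ↦ ?_,
    fun x hx ↦ ?_⟩
  · have h : freeChains.map (S ◁ coverAct b) ≫ π = π := by
      rw [← Functor.map_comp, CartesianMonoidalCategory.whiskerLeft_fst]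
    have h' : π.f n ((coverRep B S n).ρ b x) = π.f n x := congr(($h).f n x)
    exact congrArg (fun y ↦ homologyClass _ n (r y)) h'
  · refine (hcls ⟨_, d_mem_cycleSubmodule _ n x⟩).trans ?_
    rw [(homologyClass_eq_zero_iff _ n _).2 ⟨x, rfl⟩, map_zero]
  · obtain ⟨z, rfl⟩ := homologyClass_surjective _ n c
    refine ⟨⟨_, hs z⟩, congrArg (homologyClass _ n) ?_⟩
    exact (congrArg r (congr(($hsπ).f n z.1))).trans (hr z)
  · refine (homologyClass_eq_zero_iff _ n x).1 (homologyMap_fst_injective B S n ?_)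
    exact (hcls x).symm.trans (hx.trans (map_zero _).symm)

/-- A simultaneous lifting property passes to finitely supported functions. -/
lemma exists_finsupp_mapRange_eq {α M N L : Type*} [AddCommGroup M] [AddCommGroup N]
    [AddCommGroup L] (P : M → Prop) (d : N →+ M) (f : N →+ L)
    (h : ∀ m l, P m → ∃ y, d y = m ∧ f y = l) (x : α →₀ M) (l : α →₀ L) (hx : ∀ a, P (x a)) :
    ∃ y : α →₀ N, Finsupp.mapRange d (map_zero d) y = x ∧
      Finsupp.mapRange f (map_zero f) y = l := by
  classical
  choose t ht₁ ht₂ using h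
  refine ⟨Finsupp.onFinset (x.support ∪ l.support)
    (fun a ↦ if x a = 0 ∧ l a = 0 then 0 else t (x a) (l a) (hx a)) fun a ha ↦ ?_, ?_, ?_⟩
  · by_contra h
    simp only [Finset.mem_union, Finsupp.mem_support_iff, not_or, not_not] at h
    exact ha (if_pos h)
  · ext a
    simp only [Finsupp.mapRange_apply, Finsupp.onFinset_apply]
    split_ifs with h
    · rw [map_zero, h.1]
    · exact ht₁ _ _ _
  · ext a
    simp only [Finsupp.mapRange_apply, Finsupp.onFinset_apply]
    split_ifs with h
    · rw [map_zero, h.2]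
    · exact ht₂ _ _ _

/-- Two quotients of the same group by the same kernel are isomorphic. -/
lemma nonempty_addEquiv_of_surjective {Z H H' : Type*} [AddCommGroup Z] [AddCommGroup H]
    [AddCommGroup H'] (π : Z →+ H) (π' : Z →+ H') (hπ : Function.Surjective π)
    (hπ' : Function.Surjective π') (h : ∀ x, π x = 0 ↔ π' x = 0) : Nonempty (H ≃+ H') :=
  ⟨(QuotientAddGroup.quotientKerEquivOfSurjective π hπ).symm.trans
    ((QuotientAddGroup.quotientAddEquivOfEq (AddSubgroup.ext h)).trans
      (QuotientAddGroup.quotientKerEquivOfSurjective π' hπ'))⟩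

variable {B S} in
lemma coverDouble_dv (p q : ℕ) (x : (Fin (q + 1) → B) →₀ coverRep B S p) :
    (coverDouble B S).dv p q x = (-1 : ℤ) ^ p • columnD B S p q x :=
  congrArg ((-1 : ℤ) ^ p • ·)
    congr($(groupHomology.inhomogeneousChains.d_def (coverRep B S p) q) x)

/-- The differential of the chains of `S × E`, as a linear map. -/
def rowD (p : ℕ) : coverRep B S (p + 1) →ₗ[ZZ.{u}] coverRep B S p :=
  ((freeChains.obj (S ⊗ cover B)).d (p + 1) p).hom

variable {B S} in
lemma coverDouble_dh (p q : ℕ) (x : (Fin q → B) →₀ coverRep B S (p + 1)) :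
    (coverDouble B S).dh p q x = Finsupp.mapRange.linearMap (rowD B S p) x :=
  congr($(groupHomology.chainsMap_id_f_hom_eq_mapRange q (coverRepD B S p)) x)

variable {B S} in
lemma exists_coverDouble_dv {p q : ℕ} {y : (Fin (q + 1) → B) →₀ coverRep B S p}
    {x : (Fin q → B) →₀ coverRep B S p} (h : columnD B S p q y = x) :
    ∃ y, (coverDouble B S).dv p q y = x :=
  ⟨(-1 : ℤ) ^ p • y, by
    refine (coverDouble_dv p q _).trans ?_
    rw [map_zsmul, smul_smul, ← mul_pow, neg_one_mul, neg_neg, one_pow, one_smul, h]⟩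

lemma columnAug_single (p : ℕ) (g : Fin 0 → B) (x : coverRep B S p) :
    columnAug B S p (Finsupp.single g x) = (freeChains.map (S ◁ coverProj)).f p x :=
  Finsupp.lsum_single ℕ (fun _ ↦ ((freeChains.map (S ◁ coverProj)).f p).hom) g x

lemma columnAug_mapRange (p : ℕ) (x : (Fin 0 → B) →₀ coverRep B S (p + 1)) :
    columnAug B S p (Finsupp.mapRange.linearMap (rowD B S p) x) =
      (freeChains.obj (S ⊗ eilenbergMacLane B)).d (p + 1) p (columnAug B S (p + 1) x) := by
  induction x using Finsupp.induction_linear with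
  | zero => simp only [map_zero]
  | add x y hx hy =>
    rw [map_add, map_add, map_add, hx, hy]
    exact (map_add ((freeChains.obj (S ⊗ eilenbergMacLane B)).d (p + 1) p).hom _ _).symm
  | single g x =>
    refine (congrArg (columnAug B S p) (Finsupp.mapRange_single (hf := map_zero _))).trans ?_
    rw [columnAug_single, columnAug_single]
    exact congr($((freeChains.map (S ◁ coverProj)).comm (p + 1) p) x).symm

lemma columnAug_columnD (p : ℕ) (x : (Fin 1 → B) →₀ coverRep B S p) :
    columnAug B S p (columnD B S p 0 x) = 0 := by
  suffices h : columnAug B S p ∘ₗ columnD B S p 0 = 0 from congr($h x)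
  refine Finsupp.lhom_ext' fun g ↦ coverRep_lhom_ext fun x ↦ ?_
  change columnAug B S p (columnD B S p 0 (Finsupp.single g (coverSingle x))) = 0
  rw [columnD_single, Fin.sum_univ_one, map_add, map_smul, columnAug_coverSingle,
    columnAug_coverSingle]
  have h : kSimplex (fun i ↦ (g 0)⁻¹ * x.2 i) = kSimplex x.2 :=
    congr(($(coverAct_coverProj (g 0)⁻¹)).app _ x.2)
  rw [h]
  have h' {M : Type u} [AddCommGroup M] [Module ZZ.{u} M] (a : M) :
      a + (-1 : ZZ.{u}) ^ (((0 : Fin 1) : ℕ) + 1) • a = 0 := by simp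
  exact h' _

/-- The columns of the double complex resolve the chains of `S × K(B)`. -/
lemma exists_classMap_coverDouble (n : ℕ) :
    ∃ π : (coverDouble B S).cycles n →+
      (freeChains.obj (S ⊗ eilenbergMacLane B)).homology n, Function.Surjective π ∧
      ∀ x, π x = 0 ↔ x.1 ∈ (coverDouble B S).boundaries n :=
  (coverDouble B S).exists_classMap_of_columns
    (freeChains.obj (S ⊗ eilenbergMacLane B)) (columnAug B S)
    (fun p (x : (Fin 0 → B) →₀ coverRep B S (p + 1)) ↦
      (congrArg (columnAug B S p) (coverDouble_dh p 0 x)).trans (columnAug_mapRange B S p x))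
    (fun p (x : (Fin 1 → B) →₀ coverRep B S p) ↦ by
      refine (congrArg (columnAug B S p) (coverDouble_dv p 0 x)).trans ?_
      rw [map_zsmul]
      exact (congrArg _ (columnAug_columnD B S p x)).trans (smul_zero _))
    (fun p y ↦ ⟨_, columnAug_columnSection p y⟩)
    (fun p (x : (Fin 0 → B) →₀ coverRep B S p) hx ↦ exists_coverDouble_dv (by
      have := columnD_coverContraction_zero p x
      rwa [show columnAug B S p x = 0 from hx, map_zero, sub_zero] at this))
    (fun p q (x : (Fin (q + 1) → B) →₀ coverRep B S p) hx ↦ exists_coverDouble_dv (by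
      have hx' : columnD B S p q x = 0 :=
        (DoubleComplex.neg_one_pow_smul_eq_zero p _).1 ((coverDouble_dv p q x).symm.trans hx)
      have := columnD_coverContraction_succ p q x
      rwa [hx', map_zero, add_zero] at this)) n

variable {B S} in
/-- The lifting condition on the rows of the double complex, for the maps of `exists_rowClass`. -/
lemma exists_lift_coverRep {p : ℕ} {α H H' : Type u} [AddCommGroup H] [Module ZZ.{u} H]
    [AddCommGroup H'] [Module ZZ.{u} H']
    (φ : coverRep B S p →ₗ[ZZ.{u}] H) (φ' : coverRep B S (p + 1) →ₗ[ZZ.{u}] H')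
    (h₁ : ∀ c, ∃ z : cycleSubmodule (freeChains.obj (S ⊗ cover B)) (p + 1), φ' z.1 = c)
    (h₂ : ∀ x : cycleSubmodule (freeChains.obj (S ⊗ cover B)) p, φ x.1 = 0 →
      ∃ y, (freeChains.obj (S ⊗ cover B)).d (p + 1) p y = x.1)
    (x : α →₀ coverRep B S p)
    (hx : ∀ g, x g ∈ cycleSubmodule (freeChains.obj (S ⊗ cover B)) p)
    (hx' : ∀ g, φ (x g) = 0) (l : α →₀ H') :
    ∃ y : α →₀ coverRep B S (p + 1), Finsupp.mapRange.linearMap (rowD B S p) y = x ∧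
      Finsupp.mapRange.linearMap φ' y = l := by
  refine exists_finsupp_mapRange_eq (fun m ↦ m ∈ cycleSubmodule (freeChains.obj (S ⊗ cover B)) p ∧
    φ m = 0) (rowD B S p).toAddMonoidHom
    φ'.toAddMonoidHom ?_ x l fun g ↦ ⟨hx g, hx' g⟩
  rintro m l ⟨hm, hm'⟩
  obtain ⟨y, hy⟩ := h₂ ⟨m, hm⟩ hm'
  obtain ⟨z, hz⟩ := h₁ (l - φ' y)
  have hz' : (freeChains.obj (S ⊗ cover B)).d (p + 1) p z.1 = 0 := z.2
  refine ⟨y + z.1, ?_, ?_⟩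
  · refine (map_add ((freeChains.obj (S ⊗ cover B)).d (p + 1) p).hom y z.1).trans ?_
    refine (congrArg₂ (· + ·) hy hz').trans (add_zero _)
  · refine (map_add φ' _ _).trans ?_
    rw [hz, add_sub_cancel]

/-- The rows of the double complex have the homology of `S`: the double complex may be replaced by
the one with columns the chains of `B` with constant coefficients in the homology of `S`, and zero
horizontal differential. -/
lemma exists_cycles_coverDouble (n : ℕ) :
    ∃ F : (coverDouble B S).cycles n →+ (DoubleComplex.ofColumns (fun p ↦
      groupHomology.inhomogeneousChains (Rep.trivial ZZ.{u} B ((freeChains.obj S).homology p)))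
        0 fun _ ↦ zero_comp).cycles n, Function.Surjective F ∧
      ∀ x, (F x).1 ∈ (DoubleComplex.ofColumns (fun p ↦
      groupHomology.inhomogeneousChains (Rep.trivial ZZ.{u} B ((freeChains.obj S).homology p)))
        0 fun _ ↦ zero_comp).boundaries n ↔ x.1 ∈ (coverDouble B S).boundaries n := by
  choose φ hφ₁ hφ₂ hφ₃ hφ₄ using exists_rowClass B S
  let Φ (p : ℕ) : coverRep B S p ⟶ Rep.trivial ZZ.{u} B ((freeChains.obj S).homology p) :=
    Rep.ofHom ⟨φ p, fun b ↦ LinearMap.ext (hφ₁ p b)⟩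
  have hf (p q : ℕ) (x : (Fin q → B) →₀ coverRep B S p) :
      ((groupHomology.chainsMap (MonoidHom.id B) (Φ p)).f q).hom x =
        Finsupp.mapRange.linearMap (φ p) x :=
    congr($(groupHomology.chainsMap_id_f_hom_eq_mapRange q (Φ p)) x)
  refine DoubleComplex.cycles_of_rows (D := coverDouble B S) (D' := DoubleComplex.ofColumns (fun p ↦
      groupHomology.inhomogeneousChains (Rep.trivial ZZ.{u} B ((freeChains.obj S).homology p)))
        0 fun _ ↦ zero_comp)
    (fun p q ↦ ((groupHomology.chainsMap (MonoidHom.id B) (Φ p)).f q).hom) ?_ ?_ ?_ ?_ ?_ n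
  · intro p q (x : (Fin q → B) →₀ coverRep B S (p + 1))
    refine (congrArg _ (coverDouble_dh p q x)).trans ((hf p q _).trans ?_)
    refine Finsupp.ext fun g ↦ ?_
    exact hφ₂ p (x g)
  · let Ψ (p : ℕ) : groupHomology.inhomogeneousChains (coverRep B S p) ⟶
        groupHomology.inhomogeneousChains
          (Rep.trivial ZZ.{u} B ((freeChains.obj S).homology p)) :=
      groupHomology.chainsMap (MonoidHom.id B) (Φ p)
    exact DoubleComplex.ofColumns_map_dv Ψ
  · intro q l
    obtain ⟨y, hy⟩ := Finsupp.mapRange_surjective (φ 0) (map_zero _)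
      (fun c ↦ (hφ₃ 0 c).elim fun z hz ↦ ⟨z.1, hz⟩) l
    exact ⟨y, (hf 0 q y).trans hy⟩
  · intro q (x : (Fin q → B) →₀ coverRep B S 0) l hx
    obtain ⟨y, hy, hyl⟩ := exists_lift_coverRep (φ 0) (φ 1) (hφ₃ 1) (hφ₄ 0) x
      (fun g ↦ congr($((freeChains.obj (S ⊗ cover B)).shape 0 0 (by simp)) (x g)))
      (fun g ↦ congr($((hf 0 q x).symm.trans hx) g)) l
    exact ⟨y, (coverDouble_dh 0 q y).trans hy, (hf 1 q y).trans hyl⟩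
  · intro p q (x : (Fin q → B) →₀ coverRep B S (p + 1)) l hx hx'
    have hdx : Finsupp.mapRange.linearMap (rowD B S p) x = (0 : (Fin q → B) →₀ coverRep B S p) :=
      (coverDouble_dh p q x).symm.trans hx
    obtain ⟨y, hy, hyl⟩ := exists_lift_coverRep (φ (p + 1)) (φ (p + 2)) (hφ₃ (p + 2))
      (hφ₄ (p + 1)) x (fun g ↦ congr($hdx g))
      (fun g ↦ congr($((hf (p + 1) q x).symm.trans hx') g)) l
    exact ⟨y, (coverDouble_dh (p + 1) q y).trans hy, (hf (p + 2) q y).trans hyl⟩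

/-- The homology of `S × K(B)` in degree three, in terms of the homology of `B` with constant
coefficients in the homology of `S`. -/
theorem nonempty_homology_three_addEquiv :
    Nonempty ((freeChains.obj (S ⊗ eilenbergMacLane B)).homology 3 ≃+
      groupHomology (Rep.trivial ZZ.{u} B ((freeChains.obj S).homology 0)) 3 ×
      groupHomology (Rep.trivial ZZ.{u} B ((freeChains.obj S).homology 1)) 2 ×
      groupHomology (Rep.trivial ZZ.{u} B ((freeChains.obj S).homology 2)) 1 ×
      groupHomology (Rep.trivial ZZ.{u} B ((freeChains.obj S).homology 3)) 0) := by
  obtain ⟨π₁, hπ₁, hπ₁'⟩ := exists_classMap_coverDouble B S 3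
  obtain ⟨π₂, hπ₂, hπ₂'⟩ := DoubleComplex.exists_classMap_of_dh_eq_zero fun p ↦
    groupHomology.inhomogeneousChains (Rep.trivial ZZ.{u} B ((freeChains.obj S).homology p))
  obtain ⟨F, hF, hF'⟩ := exists_cycles_coverDouble B S 3
  exact nonempty_addEquiv_of_surjective π₁
    (π₂.comp F) hπ₁ (hπ₂.comp hF) fun x ↦
      (hπ₁' x).trans ((hF' x).symm.trans (hπ₂' (F x)).symm)

end

/-! ### The derived tensor product from a presentation -/

section
variable {R : Type u} [CommRing R]

section TwoTerm
variable {P₁ P₀ H : ModuleCat.{u} R}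

/-- The terms of a two-term complex. -/
def twoTermX (P₁ P₀ : ModuleCat.{u} R) : ℕ → ModuleCat.{u} R := fun n ↦
  match n with
  | 0 => P₀
  | 1 => P₁
  | _ + 2 => ModuleCat.of R PUnit

/-- The differentials of a two-term complex. -/
def twoTermD (i : P₁ ⟶ P₀) : ∀ n, twoTermX P₁ P₀ (n + 1) ⟶ twoTermX P₁ P₀ n := fun n ↦
  match n with
  | 0 => i
  | _ + 1 => 0

/-- A morphism, as a chain complex in degrees one and zero. -/
def twoTerm (i : P₁ ⟶ P₀) : ChainComplex (ModuleCat.{u} R) ℕ :=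
  ChainComplex.of (twoTermX P₁ P₀) (twoTermD i) fun n ↦ by
    cases n <;> exact zero_comp

lemma twoTerm_d (i : P₁ ⟶ P₀) (n : ℕ) : (twoTerm i).d (n + 1) n = twoTermD i n :=
  ChainComplex.of_d ..

/-- A presentation by projective modules with injective relations, as a projective resolution. -/
def twoTermResolution (i : P₁ ⟶ P₀) (p : P₀ ⟶ H) [Projective P₁] [Projective P₀]
    (w : i ≫ p = 0) (hS : (ShortComplex.mk i p w).ShortExact) : ProjectiveResolution H where
  complex := twoTerm i
  projective n := by
    match n with
    | 0 => exact ‹Projective P₀›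
    | 1 => exact ‹Projective P₁›
    | n + 2 => exact (ModuleCat.isZero_of_subsingleton (ModuleCat.of R PUnit)).projective
  π := (ChainComplex.toSingle₀Equiv _ _).symm ⟨p, by rw [twoTerm_d]; exact w⟩
  quasiIso := ⟨fun n ↦ by
    match n with
    | 0 =>
      rw [ChainComplex.quasiIsoAt₀_iff, ShortComplex.quasiIso_iff_of_zeros']
      · refine (ShortComplex.exact_and_epi_g_iff_of_iso (S₂ := ShortComplex.mk i p w) ?_).2
          ⟨hS.exact, hS.epi_g⟩
        refine ShortComplex.isoMk (Iso.refl _) (Iso.refl _) (Iso.refl _) ?_ ?_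
        · exact (Category.id_comp _).trans ((twoTerm_d i 0).symm.trans (Category.comp_id _).symm)
        · exact (Category.id_comp _).trans ((ChainComplex.toSingle₀Equiv_symm_apply_f_zero
            (C := twoTerm i) p (by rw [twoTerm_d]; exact w)).symm.trans (Category.comp_id _).symm)
      all_goals rfl
    | 1 =>
      rw [quasiIsoAt_iff_exactAt']
      · rw [HomologicalComplex.exactAt_iff' _ 2 1 0 (by simp) (by simp),
          ShortComplex.moduleCat_exact_iff]
        intro x hx
        have hx' : i x = 0 := congr($(twoTerm_d i 0) x).symm.trans hx
        exact ⟨0, (map_zero _).trans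
          ((ModuleCat.mono_iff_injective i).1 hS.mono_f (hx'.trans (map_zero _).symm)).symm⟩
      · apply ChainComplex.exactAt_succ_single_obj
    | n + 2 =>
      rw [quasiIsoAt_iff_exactAt']
      · exact HomologicalComplex.ExactAt.of_isZero
          (ModuleCat.isZero_of_subsingleton (ModuleCat.of R PUnit))
      · apply ChainComplex.exactAt_succ_single_obj⟩

end TwoTerm

/-- `Tor_1` from a presentation by projective modules with injective relations. -/
lemma nonempty_tor_one_addEquiv {M P₁ P₀ H : Type u} [AddCommGroup M] [Module R M]
    [AddCommGroup P₁] [Module R P₁] [AddCommGroup P₀] [Module R P₀] [AddCommGroup H] [Module R H]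
    [Module.Projective R P₁] [Module.Projective R P₀] (i : P₁ →ₗ[R] P₀) (p : P₀ →ₗ[R] H)
    (hi : Function.Injective i) (hip : Function.Exact i p) (hp : Function.Surjective p) :
    Nonempty (((Tor (ModuleCat.{u} R) 1).obj (ModuleCat.of R M)).obj (ModuleCat.of R H) ≃+
      LinearMap.ker (i.lTensor M)) := by
  have : Projective (ModuleCat.of R P₁) := (IsProjective.iff_projective P₁).1 inferInstance
  have : Projective (ModuleCat.of R P₀) := (IsProjective.iff_projective P₀).1 inferInstance
  have w : ModuleCat.ofHom i ≫ ModuleCat.ofHom p = 0 :=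
    ModuleCat.hom_ext (LinearMap.ext fun x ↦ (hip _).2 ⟨x, rfl⟩)
  let P := twoTermResolution (ModuleCat.ofHom i) (ModuleCat.ofHom p) w
    { exact := (ShortComplex.moduleCat_exact_iff _).2 fun x hx ↦ (hip x).1 hx
      mono_f := (ModuleCat.mono_iff_injective _).2 hi
      epi_g := (ModuleCat.epi_iff_surjective _).2 hp }
  let C := (((tensoringLeft (ModuleCat.{u} R)).obj
    (ModuleCat.of R M)).mapHomologicalComplex (ComplexShape.down ℕ)).obj P.complex
  have hC₁ : C.d 1 0 = (ModuleCat.of R M) ◁ ModuleCat.ofHom i :=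
    congrArg (ModuleCat.of R M ◁ ·) (twoTerm_d (ModuleCat.ofHom i) 0)
  have hC₂ : C.d 2 1 = 0 :=
    (congrArg (ModuleCat.of R M ◁ ·) (twoTerm_d (ModuleCat.ofHom i) 1)).trans
      (MonoidalPreadditive.whiskerLeft_zero)
  have hker : ∀ x : C.X 1, x ∈ cycleSubmodule C 1 ↔ i.lTensor M x = 0 := fun x ↦ by
    change (C.d 1 0).hom x = 0 ↔ _
    rw [hC₁]
    rfl
  let f : cycleSubmodule C 1 →+ LinearMap.ker (i.lTensor M) :=
    { toFun := fun x ↦ ⟨x.1, (hker _).1 x.2⟩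
      map_zero' := rfl
      map_add' := fun _ _ ↦ rfl }
  have hf (x : cycleSubmodule C 1) : homologyClass C 1 x = 0 ↔ f x = 0 := by
    rw [homologyClass_eq_zero_iff, hC₂]
    constructor
    · rintro ⟨_, h⟩
      exact Subtype.ext h.symm
    · exact fun h ↦ ⟨0, congrArg Subtype.val h.symm⟩
  have e := nonempty_addEquiv_of_surjective (homologyClass C 1).toAddMonoidHom f
    (homologyClass_surjective C 1) (fun y ↦ ⟨⟨y.1, (hker _).2 y.2⟩, rfl⟩) hf
  exact ⟨(P.isoLeftDerivedObj _ 1).toLinearEquiv.toAddEquiv.trans e.some⟩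

end

/-! ### The universal coefficient theorem in degree two -/

section
variable {R : Type u} [CommRing R]

/-- The universal coefficient theorem in degree two. The complex `C'` is `M ⊗ C`, given by
isomorphisms `t` in each degree. With `Z`, `B` the cycles and boundaries of `C`, the complex splits
in degree two as `Z₂ ⊕ B₁`, so the cycles of `M ⊗ C` are `M ⊗ Z₂` and the kernel of
`M ⊗ B₁ → M ⊗ Z₁`, which is the `Tor` term. -/
lemma nonempty_homology_two_addEquiv (hR : IsHereditary R) (C C' : ChainComplex (ModuleCat.{u} R) ℕ)
    [∀ n, Module.Projective R (C.X n)] (M : Type u) [AddCommGroup M] [Module R M]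
    (t : ∀ n, M ⊗[R] C.X n ≃ₗ[R] C'.X n)
    (ht : ∀ n x, C'.d (n + 1) n (t (n + 1) x) = t n ((C.d (n + 1) n).hom.lTensor M x)) :
    Nonempty (C'.homology 2 ≃+ (M ⊗[R] C.homology 2) ×
      ((Tor (ModuleCat.{u} R) 1).obj (ModuleCat.of R M)).obj (C.homology 1)) := by
  obtain ⟨r₂, hr₂⟩ := exists_cycleRetraction hR C 2
  obtain ⟨r₁, hr₁⟩ := exists_cycleRetraction hR C 1
  let d₂ : C.X 2 →ₗ[R] C.X 1 := (C.d 2 1).hom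
  let i₂ : cycleSubmodule C 2 →ₗ[R] C.X 2 := (cycleSubmodule C 2).subtype
  let i₁ : cycleSubmodule C 1 →ₗ[R] C.X 1 := (cycleSubmodule C 1).subtype
  have : Module.Projective R (LinearMap.range d₂) := hR _ _
  have : Module.Projective R (cycleSubmodule C 1) := hR _ _
  let q : C.X 2 →ₗ[R] LinearMap.range d₂ := d₂.rangeRestrict
  obtain ⟨s, hs⟩ : ∃ s : LinearMap.range d₂ →ₗ[R] C.X 2, q ∘ₗ s = LinearMap.id :=
    Module.projective_lifting_property q LinearMap.id d₂.surjective_rangeRestrict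
  have hB (x : C.X 2) : d₂ x ∈ cycleSubmodule C 1 := d_mem_cycleSubmodule C 1 x
  let j : LinearMap.range d₂ →ₗ[R] cycleSubmodule C 1 :=
    Submodule.inclusion (by rintro _ ⟨x, rfl⟩; exact hB x)
  let d₃ : C.X 3 →ₗ[R] cycleSubmodule C 2 :=
    LinearMap.codRestrict _ (C.d 3 2).hom (d_mem_cycleSubmodule C 2)
  -- the cycles are direct summands, so they remain submodules after tensoring
  have hi₂ : Function.Injective (i₂.lTensor M) := by
    have h : r₂ ∘ₗ i₂ = LinearMap.id := LinearMap.ext hr₂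
    refine Function.LeftInverse.injective (g := r₂.lTensor M) fun x ↦ ?_
    rw [← LinearMap.comp_apply, ← LinearMap.lTensor_comp, h, LinearMap.lTensor_id]
    rfl
  have hi₁ : Function.Injective (i₁.lTensor M) := by
    have h : r₁ ∘ₗ i₁ = LinearMap.id := LinearMap.ext hr₁
    refine Function.LeftInverse.injective (g := r₁.lTensor M) fun x ↦ ?_
    rw [← LinearMap.comp_apply, ← LinearMap.lTensor_comp, h, LinearMap.lTensor_id]
    rfl
  have hqs (b) : q.lTensor M (s.lTensor M b) = b := by
    rw [← LinearMap.comp_apply, ← LinearMap.lTensor_comp, hs, LinearMap.lTensor_id]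
    rfl
  have hqi (a) : q.lTensor M (i₂.lTensor M a) = 0 := by
    have h : q ∘ₗ i₂ = 0 := LinearMap.ext fun x ↦ Subtype.ext x.2
    rw [← LinearMap.comp_apply, ← LinearMap.lTensor_comp, h, LinearMap.lTensor_zero]
    rfl
  have hd₂M (x) : d₂.lTensor M x = i₁.lTensor M (j.lTensor M (q.lTensor M x)) := by
    rw [← LinearMap.comp_apply, ← LinearMap.comp_apply, ← LinearMap.lTensor_comp,
      ← LinearMap.lTensor_comp]
    rfl
  have hd₃M (y) : (C.d 3 2).hom.lTensor M y = i₂.lTensor M (d₃.lTensor M y) := by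
    rw [← LinearMap.comp_apply, ← LinearMap.lTensor_comp]
    rfl
  have hker (x : M ⊗[R] C.X 2) : t 2 x ∈ cycleSubmodule C' 2 ↔ j.lTensor M (q.lTensor M x) = 0 := by
    change C'.d 2 1 (t 2 x) = 0 ↔ _
    rw [ht 1 x]
    refine (t 1).map_eq_zero_iff.trans ?_
    change d₂.lTensor M x = 0 ↔ _
    rw [hd₂M]
    exact map_eq_zero_iff _ hi₁
  have hexact₂ : Function.Exact (i₂.lTensor M) (q.lTensor M) :=
    lTensor_exact M (fun x ↦ by
      refine Subtype.ext_iff.trans ⟨fun h ↦ ⟨⟨x, h⟩, rfl⟩, ?_⟩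
      rintro ⟨x, rfl⟩
      exact x.2) d₂.surjective_rangeRestrict
  have hexact₃ : Function.Exact (d₃.lTensor M) ((homologyClass C 2).lTensor M) :=
    lTensor_exact M (fun x ↦ by
      refine (homologyClass_eq_zero_iff C 2 x).trans ⟨fun ⟨y, h⟩ ↦ ⟨y, Subtype.ext h⟩, ?_⟩
      rintro ⟨y, rfl⟩
      exact ⟨y, rfl⟩) (homologyClass_surjective C 2)
  obtain ⟨e⟩ := nonempty_tor_one_addEquiv (M := M) j (homologyClass C 1)
    (Submodule.inclusion_injective _) (fun x ↦ by
      refine (homologyClass_eq_zero_iff C 1 x).trans ⟨fun ⟨y, h⟩ ↦ ⟨q y, Subtype.ext h⟩, ?_⟩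
      rintro ⟨⟨_, y, rfl⟩, rfl⟩
      exact ⟨y, rfl⟩) (homologyClass_surjective C 1)
  -- the splitting of `M ⊗ C₂`
  let g : (M ⊗[R] cycleSubmodule C 2) × LinearMap.ker (j.lTensor M) →ₗ[R] M ⊗[R] C.X 2 :=
    (i₂.lTensor M).coprod (s.lTensor M ∘ₗ Submodule.subtype _)
  have hqg (x) : q.lTensor M (g x) = x.2 := by
    change q.lTensor M (i₂.lTensor M x.1 + s.lTensor M x.2) = _
    rw [map_add, hqi, hqs, zero_add]
  let z : (M ⊗[R] cycleSubmodule C 2) × LinearMap.ker (j.lTensor M) →ₗ[R] cycleSubmodule C' 2 :=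
    LinearMap.codRestrict _ ((t 2).toLinearMap ∘ₗ g) fun x ↦ (hker _).2 (by rw [hqg]; exact x.2.2)
  let π' : (M ⊗[R] cycleSubmodule C 2) × LinearMap.ker (j.lTensor M) →ₗ[R]
      (M ⊗[R] C.homology 2) × LinearMap.ker (j.lTensor M) :=
    ((homologyClass C 2).lTensor M).prodMap LinearMap.id
  have hz : Function.Surjective z := by
    rintro ⟨x, hx⟩
    obtain ⟨x, rfl⟩ := (t 2).surjective x
    have hx := (hker x).1 hx
    obtain ⟨a, ha⟩ := (hexact₂ (x - s.lTensor M (q.lTensor M x))).1 (by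
      rw [map_sub, hqs, sub_self])
    refine ⟨(a, ⟨q.lTensor M x, hx⟩), Subtype.ext (congrArg (t 2) ?_)⟩
    change i₂.lTensor M a + s.lTensor M (q.lTensor M x) = x
    rw [ha, sub_add_cancel]
  have e' := nonempty_addEquiv_of_surjective (homologyClass C' 2 ∘ₗ z).toAddMonoidHom
    π'.toAddMonoidHom ((homologyClass_surjective C' 2).comp hz)
    (Function.Surjective.prodMap
      (LinearMap.lTensor_surjective M (homologyClass_surjective C 2)) Function.surjective_id)
    (fun ⟨a, b⟩ ↦ by
      refine (homologyClass_eq_zero_iff C' 2 _).trans ?_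
      change (∃ y, C'.d 3 2 y = t 2 (g (a, b))) ↔ _
      refine Iff.trans ?_ Prod.ext_iff.symm
      change _ ↔ (homologyClass C 2).lTensor M a = 0 ∧ b = 0
      constructor
      · rintro ⟨y, hy⟩
        obtain ⟨y, rfl⟩ := (t 3).surjective y
        have hy := (t 2).injective ((ht 2 y).symm.trans hy)
        rw [hd₃M] at hy
        have hb := congrArg (q.lTensor M) hy
        rw [hqi, hqg] at hb
        have hb : b = 0 := Subtype.ext hb.symm
        subst hb
        refine ⟨(hexact₃ a).2 ⟨y, hi₂ (hy.trans ?_)⟩, rfl⟩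
        change i₂.lTensor M a + s.lTensor M 0 = _
        rw [map_zero, add_zero]
      · rintro ⟨ha, rfl⟩
        obtain ⟨y, rfl⟩ := (hexact₃ a).1 ha
        refine ⟨t 3 y, (ht 2 y).trans (congrArg (t 2) ?_)⟩
        rw [hd₃M]
        change _ = i₂.lTensor M _ + s.lTensor M 0
        rw [map_zero, add_zero]
        rfl)
  exact ⟨e'.some.trans (AddEquiv.prodCongr (AddEquiv.refl _) e.symm)⟩

end

/-! ### Group homology with trivial coefficients -/

section
variable {k : Type u} [CommRing k] (B : Type u) [Group B]

/-- A map of free modules and the corresponding map with coefficients in `M` agree after tensoring;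
it suffices that they agree on the coefficient maps `k → M`. -/
lemma finsuppScalarRight_lTensor {M ι κ : Type u} [AddCommGroup M] [Module k M] [DecidableEq ι]
    [DecidableEq κ] (f : (ι →₀ M) →ₗ[k] (κ →₀ M)) (f₀ : (ι →₀ k) →ₗ[k] (κ →₀ k))
    (h : ∀ m y, f (Finsupp.mapRange.linearMap (LinearMap.toSpanSingleton k M m) y) =
      Finsupp.mapRange.linearMap (LinearMap.toSpanSingleton k M m) (f₀ y))
    (x : M ⊗[k] (ι →₀ k)) :
    f (TensorProduct.finsuppScalarRight k k M ι x) =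
      TensorProduct.finsuppScalarRight k k M κ (f₀.lTensor M x) := by
  have ht {ι : Type u} [DecidableEq ι] (m : M) (y : ι →₀ k) :
      TensorProduct.finsuppScalarRight k k M ι (m ⊗ₜ y) =
        Finsupp.mapRange.linearMap (LinearMap.toSpanSingleton k M m) y :=
    Finsupp.ext fun g ↦ TensorProduct.finsuppScalarRight_apply_tmul_apply ..
  induction x with
  | zero => simp only [map_zero]
  | add x y hx hy => simp only [map_add, hx, hy]
  | tmul m y => rw [ht, h, LinearMap.lTensor_tmul, ht]

/-- The differential of the inhomogeneous chains with trivial coefficients, as a linear map. -/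
def trivialD (M : Type u) [AddCommGroup M] [Module k M] (n : ℕ) :
    ((Fin (n + 1) → B) →₀ M) →ₗ[k] ((Fin n → B) →₀ M) :=
  ((groupHomology.inhomogeneousChains (Rep.trivial k B M)).d (n + 1) n).hom

/-- The map of coefficients `k → M` defined by an element of `M`. -/
def trivialSpan {M : Type u} [AddCommGroup M] [Module k M] (m : M) :
    Rep.trivial k B k ⟶ Rep.trivial k B M :=
  Rep.ofHom ⟨LinearMap.toSpanSingleton k M m, fun _ ↦ rfl⟩

variable {B} in
lemma chainsMap_trivialSpan {M : Type u} [AddCommGroup M] [Module k M] (m : M) (n : ℕ)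
    (y : (Fin n → B) →₀ k) :
    ((groupHomology.chainsMap (A := Rep.trivial k B k) (B := Rep.trivial k B M)
      (MonoidHom.id B) (trivialSpan B m)).f n).hom y =
      Finsupp.mapRange.linearMap (LinearMap.toSpanSingleton k M m) y :=
  congr($(groupHomology.chainsMap_id_f_hom_eq_mapRange n (trivialSpan B m)) y)

lemma trivialD_toSpanSingleton (M : Type u) [AddCommGroup M] [Module k M] (n : ℕ) (m : M)
    (y : (Fin (n + 1) → B) →₀ k) :
    trivialD (k := k) B M n (Finsupp.mapRange.linearMap (LinearMap.toSpanSingleton k M m) y) =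
      Finsupp.mapRange.linearMap (LinearMap.toSpanSingleton k M m)
        (trivialD (k := k) B k n y) := by
  have h₁ := congrArg (trivialD (k := k) B M n) (chainsMap_trivialSpan m (n + 1) y)
  have h₂ := chainsMap_trivialSpan m n (trivialD (k := k) B k n y)
  have h₃ := congr(($((groupHomology.chainsMap (A := Rep.trivial k B k)
    (B := Rep.trivial k B M) (MonoidHom.id B) (trivialSpan B m)).comm (n + 1) n)).hom y)
  exact h₁.symm.trans (h₃.trans h₂)

/-- The universal coefficient theorem for the second homology of a group. -/
lemma nonempty_groupHomology_two_addEquiv (hk : IsHereditary k) (M : Type u) [AddCommGroup M]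
    [Module k M] :
    Nonempty (groupHomology (Rep.trivial k B M) 2 ≃+
      (M ⊗[k] groupHomology (Rep.trivial k B k) 2) ×
        ((Tor (ModuleCat.{u} k) 1).obj (ModuleCat.of k M)).obj
          (groupHomology (Rep.trivial k B k) 1)) := by
  classical
  have (n : ℕ) : Module.Projective k
      ((groupHomology.inhomogeneousChains (Rep.trivial k B k)).X n) :=
    inferInstanceAs (Module.Projective k ((Fin n → B) →₀ k))
  exact nonempty_homology_two_addEquiv hk
    (groupHomology.inhomogeneousChains (Rep.trivial k B k))
    (groupHomology.inhomogeneousChains (Rep.trivial k B M)) M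
    (fun n ↦ TensorProduct.finsuppScalarRight k k M (Fin n → B)) fun n ↦
      finsuppScalarRight_lTensor (trivialD (k := k) B M n) (trivialD (k := k) B k n)
        (trivialD_toSpanSingleton B M n)

/-- Homology with trivial coefficients depends only on the coefficient module. -/
def groupHomologyTrivialCongr {M M' : Type u} [AddCommGroup M] [Module k M] [AddCommGroup M']
    [Module k M'] (e : M ≃ₗ[k] M') (n : ℕ) :
    groupHomology (Rep.trivial k B M) n ≃+ groupHomology (Rep.trivial k B M') n :=
  ((groupHomology.functor k B n).mapIso
    ((Rep.trivialFunctor k B).mapIso e.toModuleIso)).toLinearEquiv.toAddEquiv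

end

/-- Over a quotient of `ℤ`, the tensor product is that of abelian groups. Its factors are exchanged
here, as the first homology with trivial coefficients comes with the abelianization on the
left. -/
def tensorIntComm {R : Type u} [CommRing R] (hR : Function.Surjective (Int.cast : ℤ → R))
    (X Y : Type u) [AddCommGroup X] [AddCommGroup Y] [Module R X] [Module R Y] :
    X ⊗[ℤ] Y ≃+ Y ⊗[R] X := by
  have h (r : R) (x : X) (y : Y) : (r • x) ⊗ₜ[ℤ] y = x ⊗ₜ[ℤ] (r • y) := by
    obtain ⟨n, rfl⟩ := hR r
    rw [Int.cast_smul_eq_zsmul, Int.cast_smul_eq_zsmul, TensorProduct.smul_tmul]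
  have h' (n : ℤ) (x : X) (y : Y) : y ⊗ₜ[R] (n • x) = (n • y) ⊗ₜ[R] x :=
    (TensorProduct.smul_tmul n y x).symm
  let f : X ⊗[ℤ] Y →+ Y ⊗[R] X :=
    TensorProduct.liftAddHom (AddMonoidHom.mk' (fun x ↦ AddMonoidHom.mk'
      (fun y ↦ y ⊗ₜ[R] x)
      fun _ _ ↦ TensorProduct.add_tmul ..) fun _ _ ↦ AddMonoidHom.ext fun _ ↦
        TensorProduct.tmul_add ..) fun n x y ↦ h' n x y
  let g : Y ⊗[R] X →+ X ⊗[ℤ] Y :=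
    TensorProduct.liftAddHom (AddMonoidHom.mk' (fun y ↦ AddMonoidHom.mk'
      (fun x ↦ x ⊗ₜ[ℤ] y) fun _ _ ↦ TensorProduct.add_tmul ..) fun _ _ ↦ AddMonoidHom.ext fun _ ↦
        TensorProduct.tmul_add ..) fun n y x ↦ (h n x y).symm
  exact
    { f with
      invFun := g
      left_inv := fun t ↦ by
        induction t with
        | zero => exact (congrArg g (map_zero f)).trans (map_zero g)
        | add s t hs ht =>
          exact (congrArg g (map_add f s t)).trans ((map_add g _ _).trans (congrArg₂ _ hs ht))
        | tmul x y => rfl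
      right_inv := fun t ↦ by
        induction t with
        | zero => exact (congrArg f (map_zero g)).trans (map_zero f)
        | add s t hs ht =>
          exact (congrArg f (map_add g s t)).trans ((map_add f _ _).trans (congrArg₂ _ hs ht))
        | tmul x y => rfl }

/-! ### The terms of the Künneth formula -/

section
variable {R : Type u} [CommRing R]

/-- Over a quotient of `ℤ`, additive equivalences are linear. -/
def linearOfAddEquiv (hR : Function.Surjective (Int.cast : ℤ → R)) {M N : Type u}
    [AddCommGroup M] [AddCommGroup N] [Module R M] [Module R N] (e : M ≃+ N) : M ≃ₗ[R] N :=
  { e with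
    map_smul' := fun r x ↦ by
      obtain ⟨n, rfl⟩ := hR r
      change e ((n : R) • x) = (n : R) • e x
      rw [Int.cast_smul_eq_zsmul, Int.cast_smul_eq_zsmul, map_zsmul] }

/-- Homology in degree one with trivial coefficients. -/
def groupHomologyOneEquiv (hR : Function.Surjective (Int.cast : ℤ → R))
    (B : Type u) [Group B] (M : Type u) [AddCommGroup M] [Module R M] [Module R (Ab B)] :
    groupHomology (Rep.trivial R B M) 1 ≃+ M ⊗[R] Ab B :=
  (groupHomology.H1AddEquivOfIsTrivial (Rep.trivial R B M)).trans (tensorIntComm hR (Ab B) M)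

/-- The first homology group is the abelianization. -/
def groupHomologyOneEquivAb (hR : Function.Surjective (Int.cast : ℤ → R))
    (B : Type u) [Group B] [Module R (Ab B)] :
    groupHomology (Rep.trivial R B R) 1 ≃ₗ[R] Ab B :=
  linearOfAddEquiv hR ((groupHomologyOneEquiv hR B R).trans
    (TensorProduct.lid R (Ab B)).toAddEquiv)

/-- The four groups that make up the third homology of a product, in terms of the homology of the
factors: `H_3(B; H_0(A))`, `H_2(B; H_1(A))`, `H_1(B; H_2(A))` and `H_0(B; H_3(A))`. The second
contributes the `Tor` term. -/
lemma nonempty_kunneth_terms (hR : Function.Surjective (Int.cast : ℤ → R))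
    (hk : IsHereditary R) (A B : Type u) [Group A] [Group B]
    [Module R (Ab A)] [Module R (Ab B)] (M : ℕ → ModuleCat.{u} R)
    (e : ∀ p, M p ≃ₗ[R] groupHomology (Rep.trivial R A R) p) :
    Nonempty (groupHomology (Rep.trivial R B (M 0)) 3 ×
      groupHomology (Rep.trivial R B (M 1)) 2 ×
      groupHomology (Rep.trivial R B (M 2)) 1 ×
      groupHomology (Rep.trivial R B (M 3)) 0 ≃+
      groupHomology (Rep.trivial R A R) 3 ×
      (groupHomology (Rep.trivial R A R) 2 ⊗[R] Ab B) ×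
      (Ab A ⊗[R] groupHomology (Rep.trivial R B R) 2) ×
      groupHomology (Rep.trivial R B R) 3 ×
      ((Tor (ModuleCat.{u} R) 1).obj (ModuleCat.of R (Ab A))).obj (ModuleCat.of R (Ab B))) := by
  have e₀ : groupHomology (Rep.trivial R B (M 0)) 3 ≃+ groupHomology (Rep.trivial R B R) 3 :=
    groupHomologyTrivialCongr B ((e 0).trans
      (groupHomology.H0IsoOfIsTrivial (Rep.trivial R A R)).toLinearEquiv) 3
  obtain ⟨e₁⟩ := nonempty_groupHomology_two_addEquiv B hk (Ab A)
  have e₁' : groupHomology (Rep.trivial R B (M 1)) 2 ≃+ groupHomology (Rep.trivial R B (Ab A)) 2 :=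
    groupHomologyTrivialCongr B ((e 1).trans (groupHomologyOneEquivAb hR A)) 2
  have eT : ((Tor (ModuleCat.{u} R) 1).obj (ModuleCat.of R (Ab A))).obj
      (groupHomology (Rep.trivial R B R) 1) ≃+
      ((Tor (ModuleCat.{u} R) 1).obj (ModuleCat.of R (Ab A))).obj (ModuleCat.of R (Ab B)) :=
    (((Tor (ModuleCat.{u} R) 1).obj (ModuleCat.of R (Ab A))).mapIso
      (groupHomologyOneEquivAb hR B).toModuleIso).toLinearEquiv.toAddEquiv
  have e₂ : groupHomology (Rep.trivial R B (M 2)) 1 ≃+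
      groupHomology (Rep.trivial R A R) 2 ⊗[R] Ab B :=
    (groupHomologyOneEquiv hR B (M 2)).trans
      (TensorProduct.congr (e 2) (LinearEquiv.refl R (Ab B))).toAddEquiv
  have e₃ : groupHomology (Rep.trivial R B (M 3)) 0 ≃+ groupHomology (Rep.trivial R A R) 3 :=
    (groupHomology.H0IsoOfIsTrivial (Rep.trivial R B (M 3))).toLinearEquiv.toAddEquiv.trans
      (e 3).toAddEquiv
  let E₁ := (e₁'.trans e₁).trans (AddEquiv.prodCongr (AddEquiv.refl _) eT)
  exact ⟨{
    toFun := fun x ↦ (e₃ x.2.2.2, e₂ x.2.2.1, (E₁ x.2.1).1, e₀ x.1, (E₁ x.2.1).2)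
    invFun := fun y ↦ (e₀.symm y.2.2.2.1, E₁.symm (y.2.2.1, y.2.2.2.2), e₂.symm y.2.1, e₃.symm y.1)
    left_inv := fun x ↦ by simp
    right_inv := fun y ↦ by simp
    map_add' := fun x y ↦ by simp }⟩

end

lemma int_cast_zz_surjective : Function.Surjective (Int.cast : ℤ → ZZ.{u}) :=
  fun n ↦ ⟨n.down, by ext; simp⟩

lemma nonempty_kunneth_tensor (A B : Type u) [Group A] [Group B] :
    Nonempty (kunnethThree A B ≃+
      (freeChains.obj (eilenbergMacLane A ⊗ eilenbergMacLane B)).homology 3) := by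
  obtain ⟨e⟩ := nonempty_homology_three_addEquiv B (eilenbergMacLane A)
  obtain ⟨e'⟩ := nonempty_kunneth_terms int_cast_zz_surjective isHereditary_zz A B
    (fun p ↦ (freeChains.obj (eilenbergMacLane A)).homology p)
    (fun p ↦ (HomologicalComplex.homologyMapIso (freeChainsKIso A) p).toLinearEquiv)
  exact ⟨(e.trans e').symm⟩

/-! ### The Künneth isomorphism and the projection to the quotients -/

section
variable (A B : Type u) [Group A] [Group B]

/-- The comparison of the Eilenberg–MacLane space of a product with the product of the
Eilenberg–MacLane spaces. -/
def kProdComparison : eilenbergMacLane (A × B) ⟶ eilenbergMacLane A ⊗ eilenbergMacLane B :=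
  CartesianMonoidalCategory.lift (eilenbergMacLaneMap (MonoidHom.fst A B))
    (eilenbergMacLaneMap (MonoidHom.snd A B))

instance : IsIso (kProdComparison A B) := by
  have (n : SimplexCategoryᵒᵖ) : IsIso ((kProdComparison A B).app n) := by
    induction n using Opposite.rec with | op n => ?_
    induction n using SimplexCategory.rec with | mk n => ?_
    refine (isIso_iff_bijective _).2 ⟨fun F F' h ↦ kSimplex_ext fun i j hij ↦ ?_, fun y ↦ ?_⟩
    · exact Prod.ext congr(kArrow (Prod.fst $h) i j hij) congr(kArrow (Prod.snd $h) i j hij)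
    · obtain ⟨F, F'⟩ := y
      refine ⟨(kEquiv (A × B) n).symm fun i ↦ (kEquiv A n F i, kEquiv B n F' i),
        Prod.ext ((kEquiv A n).injective ?_) ((kEquiv B n).injective ?_)⟩
      · refine (kEquiv_map (MonoidHom.fst A B) _).trans ?_
        exact congrArg (MonoidHom.fst A B ∘ ·) ((kEquiv (A × B) n).apply_symm_apply _)
      · refine (kEquiv_map (MonoidHom.snd A B) _).trans ?_
        exact congrArg (MonoidHom.snd A B ∘ ·) ((kEquiv (A × B) n).apply_symm_apply _)
  exact NatIso.isIso_of_isIso_app _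

/-- The Künneth theorem for the third homology of a product of groups. -/
theorem nonempty_kunnethThree_linearEquiv :
    Nonempty (kunnethThree A B ≃ₗ[ZZ.{u}] grpHomology 3 (A × B)) := by
  obtain ⟨e⟩ := nonempty_kunneth_tensor A B
  let e' : (freeChains.obj (eilenbergMacLane A ⊗ eilenbergMacLane B)).homology 3 ≃+
      grpHomology 3 (A × B) :=
    (HomologicalComplex.homologyMapIso
      (freeChains.mapIso (asIso (kProdComparison A B)).symm ≪≫
        freeChainsKIso (A × B)) 3).toLinearEquiv.toAddEquiv
  exact ⟨linearOfAddEquiv int_cast_zz_surjective (e.trans e')⟩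

end

section
variable {G H : Type u} [Group G] [Group H]

lemma eilenbergMacLaneMap_comp {K : Type u} [Group K] (f : G →* H) (g : H →* K) :
    eilenbergMacLaneMap f ≫ eilenbergMacLaneMap g = eilenbergMacLaneMap (g.comp f) := rfl

/-- An isomorphism of groups induces an isomorphism in the homology of Eilenberg–MacLane
spaces. -/
def eilenbergMacLaneHomologyCongr (e : G ≃* H) (n : ℕ) :
    spaceHomology n (eilenbergMacLane G) ≃ₗ[ZZ.{u}] spaceHomology n (eilenbergMacLane H) where
  toLinearMap := spaceHomologyMap n (eilenbergMacLaneMap e.toMonoidHom)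
  invFun := spaceHomologyMap n (eilenbergMacLaneMap e.symm.toMonoidHom)
  left_inv x := by
    change spaceHomologyMap _ _ (spaceHomologyMap _ _ x) = x
    rw [← spaceHomologyMap_comp_apply, eilenbergMacLaneMap_comp]
    have h : e.symm.toMonoidHom.comp e.toMonoidHom = MonoidHom.id G := by ext; simp
    rw [h]
    exact spaceHomologyMap_id_apply n x
  right_inv x := by
    change spaceHomologyMap _ _ (spaceHomologyMap _ _ x) = x
    rw [← spaceHomologyMap_comp_apply, eilenbergMacLaneMap_comp]
    have h : e.toMonoidHom.comp e.symm.toMonoidHom = MonoidHom.id H := by ext; simp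
    rw [h]
    exact spaceHomologyMap_id_apply n x

/-- With trivial coefficients, all one-dimensional chains are cycles. -/
lemma grpHomologyMap_one_surjective (f : G →* H) (hf : Function.Surjective f) :
    Function.Surjective (grpHomologyMap 1 f) := by
  intro y
  obtain ⟨y, rfl⟩ := homologyClass_surjective _ 1 y
  have : Epi (X := Rep.trivial ZZ.{u} G ZZ.{u})
      (Y := Rep.res f (Rep.trivial ZZ.{u} H ZZ.{u})) (𝟙 (Rep.trivial ZZ.{u} G ZZ.{u})) :=
    inferInstanceAs (Epi (𝟙 (Rep.trivial ZZ.{u} G ZZ.{u})))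
  obtain ⟨x, hx⟩ := (ModuleCat.epi_iff_surjective _).1 (groupHomology.chainsMap_f_map_epi
    (A := Rep.trivial ZZ.{u} G ZZ.{u}) (B := Rep.trivial ZZ.{u} H ZZ.{u}) f
    (𝟙 (Rep.trivial ZZ.{u} G ZZ.{u})) hf 1) y.1
  have hd : (groupHomology.inhomogeneousChains (Rep.trivial ZZ.{u} G ZZ.{u})).d 1 0 = 0 := by
    rw [groupHomology.inhomogeneousChains.d_def]
    ext
    simp [groupHomology.inhomogeneousChains.d_single (G := G), Unique.eq_default (α := Fin 0 → G)]
  refine ⟨homologyClass _ 1 ⟨x, congr($hd x)⟩, ?_⟩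
  exact homologyMap_homologyClass _ 1 _ _ hx

end

section
variable {G₁ G₂ : Type u} [Group G₁] [Group G₂] (N₁ : Subgroup G₁) [N₁.Normal]
  (N₂ : Subgroup G₂) [N₂.Normal]

lemma prodProj_surjective : Function.Surjective (prodProj N₁ N₂) :=
  (QuotientGroup.mk'_surjective N₁).prodMap (QuotientGroup.mk'_surjective N₂)

/-- The product of the quotients is the quotient of the product. -/
def prodQuotientEquiv : (G₁ ⧸ N₁) × (G₂ ⧸ N₂) ≃* (G₁ × G₂) ⧸ N₁.prod N₂ :=
  (QuotientGroup.liftEquiv (N₁.prod N₂) (φ := prodProj N₁ N₂) (prodProj_surjective N₁ N₂)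
    (by simp [MonoidHom.ker_prodMap])).symm

lemma prodQuotientEquiv_comp_prodProj :
    (prodQuotientEquiv N₁ N₂).toMonoidHom.comp (prodProj N₁ N₂) =
      QuotientGroup.mk' (N₁.prod N₂) :=
  MonoidHom.ext fun _ ↦ (prodQuotientEquiv N₁ N₂).symm.injective
    ((prodQuotientEquiv N₁ N₂).symm_apply_apply _)

end

end SchurPair

end

open SchurPair in
theorem theorem2p5 {G₁ G₂ : Type u} [Group G₁] [Group G₂]
    (N₁ : Subgroup G₁) [N₁.Normal] (N₂ : Subgroup G₂) [N₂.Normal] :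
    ∃ -- the Künneth isomorphisms in degree three
      (κ : kunnethThree G₁ G₂ ≃ₗ[ZZ.{u}] grpHomology 3 (G₁ × G₂))
      (κ' : kunnethThree (G₁ ⧸ N₁) (G₂ ⧸ N₂) ≃ₗ[ZZ.{u}]
        grpHomology 3 ((G₁ ⧸ N₁) × (G₂ ⧸ N₂)))
      -- the identifications of group homology with the homology of Eilenberg–MacLane spaces
      (θ : ∀ n, grpHomology n (G₁ × G₂) ≃ₗ[ZZ.{u}]
        spaceHomology n (eilenbergMacLane (G₁ × G₂)))
      (θ' : ∀ n, grpHomology n ((G₁ ⧸ N₁) × (G₂ ⧸ N₂)) ≃ₗ[ZZ.{u}]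
        spaceHomology n (eilenbergMacLane ((G₁ × G₂) ⧸ N₁.prod N₂)))
      -- the map `H_n(G₁/N₁ × G₂/N₂) → H_n(X)` and the connecting map `H_{n+1}(X) → H_n(G₁ × G₂)`
      (ι : ∀ n, grpHomology n ((G₁ ⧸ N₁) × (G₂ ⧸ N₂)) →ₗ[ZZ.{u}]
        spaceHomology n (pairSpace (G₁ × G₂) (N₁.prod N₂)))
      (δ : ∀ n, spaceHomology (n + 1) (pairSpace (G₁ × G₂) (N₁.prod N₂)) →ₗ[ZZ.{u}]
        grpHomology n (G₁ × G₂)),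
      -- `θ` and `θ'` are compatible with the projection, and `ι` is induced by `K(G/N) → X`
      (∀ n, (θ' n).toLinearMap ∘ₗ grpHomologyMap n (prodProj N₁ N₂) =
        spaceHomologyMap n (pairMap (G₁ × G₂) (N₁.prod N₂)) ∘ₗ (θ n).toLinearMap) ∧
      (∀ n, ι n =
        spaceHomologyMap n (pairInclusion (G₁ × G₂) (N₁.prod N₂)) ∘ₗ (θ' n).toLinearMap) ∧
      -- the displayed part of the sequence
      (let α : kunnethThree G₁ G₂ →ₗ[ZZ.{u}] kunnethThree (G₁ ⧸ N₁) (G₂ ⧸ N₂) :=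
        κ'.symm.toLinearMap ∘ₗ grpHomologyMap 3 (prodProj N₁ N₂) ∘ₗ κ.toLinearMap
      let β : kunnethThree (G₁ ⧸ N₁) (G₂ ⧸ N₂) →ₗ[ZZ.{u}]
          schurMultiplierPair (G₁ × G₂) (N₁.prod N₂) :=
        ι 3 ∘ₗ κ'.toLinearMap
      let γ : schurMultiplierPair (G₁ × G₂) (N₁.prod N₂) →ₗ[ZZ.{u}]
          schurMultiplier (G₁ × G₂) :=
        δ 2
      let ε : schurMultiplier (G₁ × G₂) →ₗ[ZZ.{u}]
          schurMultiplier ((G₁ ⧸ N₁) × (G₂ ⧸ N₂)) :=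
        schurMultiplierMap (prodProj N₁ N₂)
      Function.Exact (κ.symm.toLinearMap ∘ₗ δ 3) α ∧
        Function.Exact α β ∧ Function.Exact β γ ∧ Function.Exact γ ε ∧
        Function.Exact ε (ι 2)) ∧
      -- its continuation in both directions, down to `H_1(G₁ × G₂) → H_1(G₁/N₁ × G₂/N₂) → 0`
      (∀ n, 1 ≤ n → Function.Exact (ι (n + 1)) (δ n)) ∧
      (∀ n, 1 ≤ n → Function.Exact (δ n) (grpHomologyMap n (prodProj N₁ N₂))) ∧
      (∀ n, 2 ≤ n → Function.Exact (grpHomologyMap n (prodProj N₁ N₂)) (ι n)) ∧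
      Function.Surjective (grpHomologyMap 1 (prodProj N₁ N₂)) := by
  obtain ⟨κ⟩ := nonempty_kunnethThree_linearEquiv G₁ G₂
  obtain ⟨κ'⟩ := nonempty_kunnethThree_linearEquiv (G₁ ⧸ N₁) (G₂ ⧸ N₂)
  obtain ⟨d, h₁, h₂, h₃⟩ := exists_coneSequence (pairMap (G₁ × G₂) (N₁.prod N₂))
  let θ (n : ℕ) := grpHomologyEquiv n (G₁ × G₂)
  let θ' (n : ℕ) := (grpHomologyEquiv n ((G₁ ⧸ N₁) × (G₂ ⧸ N₂))).trans
    (eilenbergMacLaneHomologyCongr (prodQuotientEquiv N₁ N₂) n)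
  let ι (n : ℕ) : grpHomology n ((G₁ ⧸ N₁) × (G₂ ⧸ N₂)) →ₗ[ZZ.{u}]
      spaceHomology n (pairSpace (G₁ × G₂) (N₁.prod N₂)) :=
    spaceHomologyMap n (pairInclusion (G₁ × G₂) (N₁.prod N₂)) ∘ₗ (θ' n).toLinearMap
  let δ (n : ℕ) : spaceHomology (n + 1) (pairSpace (G₁ × G₂) (N₁.prod N₂)) →ₗ[ZZ.{u}]
      grpHomology n (G₁ × G₂) := (θ n).symm.toLinearMap ∘ₗ d n
  have hθ (n : ℕ) (x : grpHomology n (G₁ × G₂)) : θ' n (grpHomologyMap n (prodProj N₁ N₂) x) =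
      spaceHomologyMap n (pairMap (G₁ × G₂) (N₁.prod N₂)) (θ n x) := by
    change spaceHomologyMap n (eilenbergMacLaneMap (prodQuotientEquiv N₁ N₂).toMonoidHom)
      (grpHomologyEquiv n _ (grpHomologyMap n (prodProj N₁ N₂) x)) = _
    refine (congrArg _ congr($(grpHomologyEquiv_naturality n (prodProj N₁ N₂)) x)).trans ?_
    refine (spaceHomologyMap_comp_apply n _ _ _).symm.trans ?_
    rw [eilenbergMacLaneMap_comp, prodQuotientEquiv_comp_prodProj]
    rfl
  have e₁ (n : ℕ) (hn : 1 ≤ n) : Function.Exact (ι (n + 1)) (δ n) := fun x ↦ by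
    refine (θ n).symm.map_eq_zero_iff.trans ((h₁ n hn x).trans ?_)
    exact ((θ' (n + 1)).surjective.exists).trans Iff.rfl
  have e₂ (n : ℕ) (hn : 1 ≤ n) : Function.Exact (δ n) (grpHomologyMap n (prodProj N₁ N₂)) :=
    fun x ↦ by
      refine (θ' n).map_eq_zero_iff.symm.trans ?_
      rw [hθ n x]
      refine (h₂ n hn _).trans (exists_congr fun y ↦ ?_)
      exact (θ n).symm_apply_eq.symm
  have e₃ (n : ℕ) (hn : 1 ≤ n) : Function.Exact (grpHomologyMap n (prodProj N₁ N₂)) (ι n) :=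
    fun x ↦ by
      refine (h₃ n hn (θ' n x)).trans ((θ n).surjective.exists.trans (exists_congr fun y ↦ ?_))
      rw [← hθ n y]
      exact (θ' n).injective.eq_iff
  refine ⟨κ, κ', θ, θ', ι, δ, fun n ↦ LinearMap.ext (hθ n), fun _ ↦ rfl,
    ⟨fun x ↦ ?_, fun x ↦ ?_, fun x ↦ ?_, e₂ 2 (by norm_num), e₃ 2 (by norm_num)⟩, e₁, e₂,
    fun n hn ↦ e₃ n (by omega), grpHomologyMap_one_surjective _ (prodProj_surjective N₁ N₂)⟩
  · refine κ'.symm.map_eq_zero_iff.trans ((e₂ 3 (by norm_num) (κ x)).trans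
      (exists_congr fun y ↦ ?_))
    exact κ.symm_apply_eq.symm
  · refine (e₃ 3 (by norm_num) (κ' x)).trans (κ.surjective.exists.trans
      (exists_congr fun y ↦ ?_))
    exact κ'.symm_apply_eq.symm
  · exact (e₁ 2 (by norm_num) x).trans κ'.surjective.exists
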